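/- **Proposition (2-runs).** Let $p\in[0,1]$. There is a constant $c_p$, depending only on $p$, such that the following holds for every integer $n\ge 7$. Let $\zeta_1,\dots,\zeta_n$ be independent random variables with $\mathbb{P}(\zeta_i=1)=1-\mathbb{P}(\zeta_i=0)=p$, and let $S=\sum_{i=1}^n\zeta_i\zeta_{i+1}$, where indices are taken cyclically, i.e. $\zeta_{n+1}=\zeta_1$. Put $\mu=np^2$ and $\sigma^2=n(p^2+2p^3-3p^4)$. Then $\mathbb{E}S=\mu$, $\mathrm{Var}(S)=\sigma^2$, and $$d_{TV}\bigl(\mathcal{L}(S),N^d(\mu,\sigma^2)\bigr)\le \frac{c_p}{\sqrt n}.$$ Here $d_{TV}(\mathcal{L}(X),\mathcal{L}(Y))=\sup_{A\subseteq\mathbb{Z}}|\mathbb{P}(X\in A)-\mathbb{P}(Y\in A)|$ for integer-valued $X,Y$, and $N^d(\mu,\sigma^2)$ is the discretized normal distribution, the probability distribution on $\mathbb{Z}$ whose mass at $z\in\mathbb{Z}$ is $\mathbb{P}(z-\tfrac12\le Z<z+\tfrac12)$ for a Gaussian variable $Z$ with mean $\mu$ and variance $\sigma^2$ (for $\sigma^2=0$,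 $Z$ is the constant $\mu$). -/

import Mathlib

open MeasureTheory ProbabilityTheory

/-- Total variation distance: the supremum over all events `A` of `|μ(A) - ν(A)|`
(on `ℤ` every set is an event). -/
noncomputable def tvDist {X : Type*} [MeasurableSpace X] (μ ν : Measure X) : ℝ :=
  ⨆ A : {A : Set X // MeasurableSet A}, |μ.real A.1 - ν.real A.1|

/-- The discretized normal distribution on `ℤ` with parameters `m` and `v`: the mass at `z` is
the probability that a Gaussian variable with mean `m` and variance `v` lies in
`[z - 1/2, z + 1/2)`. It is meant for `0 ≤ v`; for `v = 0` the Gaussian is the point mass at `m`. -/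
noncomputable def discretizedNormal (m v : ℝ) : Measure ℤ :=
  Measure.sum fun z : ℤ =>
    gaussianReal m v.toNNReal (Set.Ico ((z : ℝ) - 1 / 2) ((z : ℝ) + 1 / 2)) • Measure.dirac z

/-- The cyclic 2-runs statistic `∑ i, ζ i * ζ (i + 1)`; `finRotate n` is the cyclic successor,
so the last index is followed by the first one. -/
def twoRuns {Ω : Type*} {n : ℕ} (ζ : Fin n → Ω → ℤ) (ω : Ω) : ℤ :=
  ∑ i : Fin n, ζ i ω * ζ (finRotate n i) ω

/-! Write `w = exp (i t)` and `v = p² + 2p³ - 3p⁴`. The characteristic function of `S` is `tr Mⁿ`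
for a 2×2 transfer matrix `M` (`integral_cexp_twoRuns`). At `t = 0` this matrix is a rank-one
projection, and near `0` its leading eigenvalue has logarithm `i p² t - v t²/2 + O(t³)`. The
eigenvalue itself is never followed. Instead the centred function `ψ = exp (-i n p² t) tr Mⁿ` is
shown to satisfy the Gaussian equation up to an error, `ψ' = -n v t ψ + R`. Here `R` is `n` times a
unimodular factor times `tr (D Mⁿ⁻¹)`, with the defect `D = M'/i - (p² + i v t) M`. By cyclicity of
the trace `D` may be replaced by `M² D M²`, which vanishes to second order in `t`
(`transferMatrix_sq_mul_defect_mul_sq`). With the contraction `‖M²‖ ≤ exp (-c t²)` on `[-π, π]` this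
gives `|R| ≤ C n t² exp (-κ n t²)`, and an integrating factor then bounds `E = ψ - exp (-n v t²/2)`
and `E'`.

Total variation needs an `ℓ¹` bound on Fourier coefficients. Cauchy–Schwarz with weight `1 + (z -
μ)²/n` and Parseval for `E` and `E'` reduce it to `L²` norms (`sq_sum_norm_fourier_integral_le`).
Since `E = O(n^(-1/2))` and `E' = O(1)`, both concentrated on `|t| ≲ n^(-1/2)`, the sum is
`O(n^(-1/2))`. Two errors remain: the Gaussian Fourier integral outside `[-π, π]`, exponentially
small, and the replacement of interval masses by density values, at most the total variation of the
density. For `p = 0` or `p = 1` both laws are the same point mass. -/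

/-! ### Independent Bernoulli variables -/

section Bernoulli

variable {Ω : Type*} [MeasurableSpace Ω] {P : Measure Ω} {p : unitInterval}

lemma integral_comp_of_hasLaw_bernoulli {E : Type*} [NormedAddCommGroup E] [NormedSpace ℝ E]
    [CompleteSpace E] {X : Ω → ℤ} (hX : HasLaw X (bernoulliMeasure (1 : ℤ) 0 p) P) (f : ℤ → E) :
    ∫ ω, f (X ω) ∂P = (p : ℝ) • f 1 + (1 - p : ℝ) • f 0 := by
  rw [← integral_bernoulliMeasure (1 : ℤ) 0 p f, ← hX.integral_comp]
  · rfl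
  · exact StronglyMeasurable.of_discrete.aestronglyMeasurable

lemma ae_eq_zero_or_one_of_hasLaw_bernoulli {X : Ω → ℤ}
    (hX : HasLaw X (bernoulliMeasure (1 : ℤ) 0 p) P) : ∀ᵐ ω ∂P, X ω = 0 ∨ X ω = 1 := by
  have h : ∀ᵐ z ∂(bernoulliMeasure (1 : ℤ) 0 p), z = 0 ∨ z = 1 := by
    rw [ae_iff]
    exact bernoulliMeasure_apply_of_notMem_of_notMem p (Set.to_countable _).measurableSet
      (by simp) (by simp)
  rw [← hX.map_eq] at h
  exact ae_of_ae_map hX.aemeasurable h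

variable {ι : Type*} [Fintype ι] {ζ : ι → Ω → ℤ}

lemma integral_prod_comp_of_bernoulli {𝕜 : Type*} [RCLike 𝕜]
    (hζ : ∀ i, HasLaw (ζ i) (bernoulliMeasure (1 : ℤ) 0 p) P) (hind : iIndepFun ζ P)
    (f : ι → ℤ → 𝕜) :
    ∫ ω, ∏ i, f i (ζ i ω) ∂P = ∏ i, ((p : ℝ) • f i 1 + (1 - p : ℝ) • f i 0) := by
  rw [hind.integral_fun_prod_comp (fun i => (hζ i).aemeasurable)
    (fun i => (measurable_of_countable (f i)).stronglyMeasurable.aestronglyMeasurable)]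
  exact Finset.prod_congr rfl fun i _ => integral_comp_of_hasLaw_bernoulli (hζ i) (f i)

lemma integral_prod_finset_of_bernoulli [DecidableEq ι]
    (hζ : ∀ i, HasLaw (ζ i) (bernoulliMeasure (1 : ℤ) 0 p) P) (hind : iIndepFun ζ P)
    (T : Finset ι) : ∫ ω, ∏ i ∈ T, (ζ i ω : ℝ) ∂P = (p : ℝ) ^ T.card := by
  have h := integral_prod_comp_of_bernoulli hζ hind
    (fun i z => if i ∈ T then (z : ℝ) else 1)
  have e : ∀ i, (p : ℝ) • (if i ∈ T then ((1 : ℤ) : ℝ) else 1)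
      + (1 - p : ℝ) • (if i ∈ T then ((0 : ℤ) : ℝ) else 1) = if i ∈ T then (p : ℝ) else 1 := by
    intro i
    split_ifs <;> simp
  simp only [e, Finset.prod_ite_mem, Finset.univ_inter, Finset.prod_const] at h
  exact h

/-- The joint law of independent Bernoulli variables, as a sum over all `0`-`1` configurations. -/
lemma integral_comp_family_of_bernoulli [DecidableEq ι]
    (hζ : ∀ i, HasLaw (ζ i) (bernoulliMeasure (1 : ℤ) 0 p) P) (hind : iIndepFun ζ P)
    (g : (ι → ℤ) → ℂ) :
    ∫ ω, g (fun i => ζ i ω) ∂P =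
      ∑ x : ι → Fin 2, (∏ i, (if x i = 1 then (p : ℂ) else 1 - p)) * g (fun i => (x i : ℕ)) := by
  have := hind.isProbabilityMeasure
  -- Almost surely exactly one configuration matches, so `g` becomes a finite combination of
  -- products of one-variable functions, to which independence applies.
  have hae : ∀ᵐ ω ∂P, g (fun i => ζ i ω) =
      ∑ x : ι → Fin 2, (∏ i, (if ζ i ω = (x i : ℕ) then (1 : ℂ) else 0))
        * g (fun i => (x i : ℕ)) := by
    filter_upwards [ae_all_iff.2 fun i => ae_eq_zero_or_one_of_hasLaw_bernoulli (hζ i)] with ω hω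
    have hy : ∀ i, ∃ y : Fin 2, ζ i ω = (y : ℕ) := fun i => by
      rcases hω i with h | h
      · exact ⟨0, by simp [h]⟩
      · exact ⟨1, by simp [h]⟩
    choose y hy using hy
    rw [Finset.sum_eq_single y]
    · simp [hy]
    · intro x _ hx
      obtain ⟨i, hi⟩ := Function.ne_iff.1 hx
      rw [Finset.prod_eq_zero (Finset.mem_univ i), zero_mul]
      rw [if_neg]
      rw [hy]
      intro h
      exact hi (Fin.ext (by exact_mod_cast h.symm))
    · simp
  have hint : ∀ x : ι → Fin 2, Integrable
      (fun ω => ∏ i, (if ζ i ω = (x i : ℕ) then (1 : ℂ) else 0)) P := by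
    intro x
    refine Integrable.of_bound (C := 1) ?_ (.of_forall fun ω => ?_)
    · refine Finset.aestronglyMeasurable_fun_prod _ fun i _ => ?_
      exact ((measurable_of_countable fun z : ℤ =>
        if z = (x i : ℕ) then (1 : ℂ) else 0).comp_aemeasurable
          (hζ i).aemeasurable).aestronglyMeasurable
    · rw [norm_prod]
      refine Finset.prod_le_one (fun _ _ => norm_nonneg _) fun i _ => ?_
      split_ifs <;> simp
  rw [integral_congr_ae hae, integral_finsetSum _ fun x _ => (hint x).mul_const _]
  refine Finset.sum_congr rfl fun x _ => ?_
  rw [integral_mul_const, integral_prod_comp_of_bernoulli hζ hind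
    (fun i z => if z = (x i : ℕ) then (1 : ℂ) else 0)]
  congr 1
  refine Finset.prod_congr rfl fun i _ => ?_
  generalize x i = y
  fin_cases y <;> simp

end Bernoulli

/-! ### Matrix powers as sums over paths, and indices on a cycle -/

/-- The arbitrary endpoint weight `g` makes the induction close: summing out the first vertex
absorbs one factor `A` into `g`. The choice `g a b = A b a` later closes the path into a cycle. -/
lemma sum_prod_path_mul {ι R : Type*} [Fintype ι] [DecidableEq ι] [CommSemiring R]
    (A : Matrix ι ι R) (m : ℕ) (g : ι → ι → R) :
    ∑ x : Fin (m + 1) → ι, (∏ i : Fin m, A (x i.castSucc) (x i.succ)) * g (x 0) (x (Fin.last m))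
      = ∑ a, ∑ b, (A ^ m) a b * g a b := by
  induction m generalizing g with
  | zero =>
    rw [← (Equiv.funUnique (Fin 1) ι).symm.sum_comp]
    simp [Matrix.one_apply]
  | succ m ih =>
    rw [← (Fin.consEquiv fun _ => ι).sum_comp, Fintype.sum_prod_type, Finset.sum_comm]
    have h : ∀ y : Fin (m + 1) → ι, ∑ a : ι,
        (∏ i : Fin (m + 1), A ((Fin.consEquiv fun _ => ι) (a, y) i.castSucc)
          ((Fin.consEquiv fun _ => ι) (a, y) i.succ)) *
          g ((Fin.consEquiv fun _ => ι) (a, y) 0)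
            ((Fin.consEquiv fun _ => ι) (a, y) (Fin.last (m + 1))) =
        (∏ i : Fin m, A (y i.castSucc) (y i.succ)) *
          (fun c b => ∑ a, A a c * g a b) (y 0) (y (Fin.last m)) := by
      intro y
      rw [Finset.mul_sum]
      refine Finset.sum_congr rfl fun a _ => ?_
      rw [Fin.prod_univ_succ]
      simp only [Fin.consEquiv_apply, Fin.castSucc_zero, Fin.cons_zero, Fin.cons_succ,
        ← Fin.succ_last, ← Fin.succ_castSucc]
      ring
    simp only [h]
    refine (ih fun c b => ∑ a, A a c * g a b).trans ?_
    simp only [pow_succ' A m, Matrix.mul_apply, Finset.mul_sum, Finset.sum_mul]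
    rw [Finset.sum_comm]
    conv_rhs => rw [Finset.sum_comm]
    refine Finset.sum_congr rfl fun b _ => ?_
    rw [Finset.sum_comm]
    refine Finset.sum_congr rfl fun a _ => Finset.sum_congr rfl fun c _ => ?_
    ring

/-- The transfer-matrix formula: closed paths of length `n` are counted by `trace (A ^ n)`. -/
lemma sum_prod_finRotate_eq_trace_pow {ι R : Type*} [Fintype ι] [DecidableEq ι] [CommSemiring R]
    (A : Matrix ι ι R) (m : ℕ) :
    ∑ x : Fin (m + 1) → ι, ∏ i, A (x i) (x (finRotate (m + 1) i)) =
      (A ^ (m + 1)).trace := by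
  have h := sum_prod_path_mul A m fun a b => A b a
  rw [Matrix.trace, pow_succ]
  simp only [Matrix.diag_apply, Matrix.mul_apply]
  rw [← h]
  refine Finset.sum_congr rfl fun x _ => ?_
  rw [Fin.prod_univ_castSucc]
  simp

lemma Fin.ne_add_one_of_three_le {n : ℕ} (hn : 3 ≤ n) [NeZero n] (i : Fin n) : i ≠ i + 1 := by
  obtain ⟨m, rfl⟩ := Nat.exists_eq_add_of_le' hn
  intro h
  simp at h

lemma Fin.ne_add_one_add_one_of_three_le {n : ℕ} (hn : 3 ≤ n) [NeZero n] (i : Fin n) :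
    i ≠ i + 1 + 1 := by
  obtain ⟨m, rfl⟩ := Nat.exists_eq_add_of_le' hn
  intro h
  rw [add_assoc, left_eq_add, Fin.ext_iff, Fin.val_add, Fin.val_one,
    Nat.mod_eq_of_lt (by omega)] at h
  exact absurd h (by simp)

/-! ### Characteristic function, mean and variance of the 2-runs statistic -/

section TwoRuns

variable {Ω : Type*} [MeasurableSpace Ω] {P : Measure Ω} {p : unitInterval} {n : ℕ}
  {ζ : Fin n → Ω → ℤ}

lemma aemeasurable_twoRuns (hζ : ∀ i, HasLaw (ζ i) (bernoulliMeasure (1 : ℤ) 0 p) P) :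
    AEMeasurable (twoRuns ζ) P := by
  unfold twoRuns
  exact Finset.aemeasurable_fun_sum _ fun i _ => (hζ i).aemeasurable.mul (hζ _).aemeasurable

/-- The transfer matrix of the 2-runs statistic. -/
noncomputable def transferMatrix (p w : ℂ) : Matrix (Fin 2) (Fin 2) ℂ :=
  !![1 - p, p; 1 - p, p * w]

lemma integral_cexp_twoRuns (hn : n ≠ 0)
    (hζ : ∀ i, HasLaw (ζ i) (bernoulliMeasure (1 : ℤ) 0 p) P) (hind : iIndepFun ζ P) (t : ℝ) :
    ∫ ω, Complex.exp (t * Complex.I * twoRuns ζ ω) ∂P =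
      (transferMatrix (p : ℝ) (Complex.exp (t * Complex.I)) ^ n).trace := by
  obtain ⟨m, rfl⟩ := Nat.exists_eq_succ_of_ne_zero hn
  have h := integral_comp_family_of_bernoulli hζ hind fun x =>
    Complex.exp (t * Complex.I * ((∑ i, x i * x (finRotate (m + 1) i) : ℤ) : ℂ))
  refine h.trans ?_
  rw [← sum_prod_finRotate_eq_trace_pow]
  refine Finset.sum_congr rfl fun x _ => ?_
  -- Each matrix entry carries the Bernoulli weight of the state it arrives at, so the weights are
  -- reindexed by the cyclic successor.
  rw [← Equiv.prod_comp (finRotate (m + 1)) fun i =>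
    if x i = 1 then ((p : ℝ) : ℂ) else 1 - (p : ℝ)]
  push_cast
  rw [Finset.mul_sum, Complex.exp_sum, ← Finset.prod_mul_distrib]
  refine Finset.prod_congr rfl fun i _ => ?_
  generalize x i = a
  generalize x (finRotate (m + 1) i) = b
  fin_cases a <;> fin_cases b <;> simp [transferMatrix]

lemma card_union_pair_add_one (hn : 3 ≤ n) [NeZero n] (i j : Fin n) :
    ({i, i + 1} ∪ {j, j + 1} : Finset (Fin n)).card =
      if j = i then 2 else if j = i + 1 then 3 else if j = i - 1 then 3 else 4 := by
  have h1 := Fin.ne_add_one_of_three_le hn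
  have h2 := Fin.ne_add_one_add_one_of_three_le hn
  have h3 : ∀ k : Fin n, ({k, k + 1} ∪ {k + 1, k + 1 + 1} : Finset (Fin n)) =
      {k, k + 1, k + 1 + 1} := by
    intro k
    ext
    simp only [Finset.mem_union, Finset.mem_insert, Finset.mem_singleton]
    tauto
  split_ifs with a b c
  · rw [a, Finset.union_idempotent, Finset.card_pair (h1 i)]
  · rw [b, Finset.card_eq_three]
    exact ⟨i, i + 1, i + 1 + 1, h1 _, h2 _, h1 _, h3 _⟩
  · obtain rfl : i = j + 1 := by rw [c]; abel
    rw [Finset.card_eq_three]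
    exact ⟨j, j + 1, j + 1 + 1, h1 _, h2 _, h1 _, (Finset.union_comm _ _).trans (h3 _)⟩
  · rw [Finset.card_union_of_disjoint, Finset.card_pair (h1 i), Finset.card_pair (h1 j)]
    have e : j + 1 ≠ i := fun h => c (by rw [← h]; abel)
    simp only [Finset.disjoint_insert_left, Finset.disjoint_singleton_left, Finset.mem_insert,
      Finset.mem_singleton, not_or]
    exact ⟨⟨Ne.symm a, e.symm⟩, Ne.symm b, fun h => a (add_right_cancel h).symm⟩

/-- Since `ζ² = ζ` almost surely, the product of two summands is the product of the variables over
the union of the two edges, and only the size of that union matters. -/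
lemma integral_twoRuns_summand_mul (hn : 3 ≤ n) [NeZero n]
    (hζ : ∀ i, HasLaw (ζ i) (bernoulliMeasure (1 : ℤ) 0 p) P) (hind : iIndepFun ζ P)
    (i j : Fin n) :
    ∫ ω, ((ζ i ω : ℝ) * ζ (finRotate n i) ω) * ((ζ j ω : ℝ) * ζ (finRotate n j) ω) ∂P =
      (p : ℝ) ^ (if j = i then 2 else if j = i + 1 then 3 else if j = i - 1 then 3 else 4) := by
  rw [← card_union_pair_add_one hn, ← integral_prod_finset_of_bernoulli hζ hind]
  have h1 := Fin.ne_add_one_of_three_le hn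
  refine integral_congr_ae ?_
  filter_upwards [ae_all_iff.2 fun i => ae_eq_zero_or_one_of_hasLaw_bernoulli (hζ i)] with ω hω
  have key : ∀ S T : Finset (Fin n), ∏ k ∈ S ∪ T, (ζ k ω : ℝ) =
      (∏ k ∈ S, (ζ k ω : ℝ)) * ∏ k ∈ T, (ζ k ω : ℝ) := by
    intro S T
    by_cases h : ∃ k ∈ S ∪ T, ζ k ω = 0
    · obtain ⟨k, hk, h0⟩ := h
      rw [Finset.prod_eq_zero hk (by simp [h0])]
      rcases Finset.mem_union.1 hk with hk | hk
      · rw [Finset.prod_eq_zero hk (by simp [h0]), zero_mul]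
      · rw [Finset.prod_eq_zero hk (by simp [h0]), mul_zero]
    · push Not at h
      have h' : ∀ k ∈ S ∪ T, (ζ k ω : ℝ) = 1 := fun k hk => by
        exact_mod_cast (hω k).resolve_left (h k hk)
      rw [Finset.prod_eq_one h', Finset.prod_eq_one fun k hk => h' k (Finset.mem_union_left _ hk),
        Finset.prod_eq_one fun k hk => h' k (Finset.mem_union_right _ hk), one_mul]
  rw [key, Finset.prod_pair (h1 i), Finset.prod_pair (h1 j), finRotate_apply, finRotate_apply]

lemma integral_twoRuns_summand (hn : 3 ≤ n)
    (hζ : ∀ i, HasLaw (ζ i) (bernoulliMeasure (1 : ℤ) 0 p) P) (hind : iIndepFun ζ P) (i : Fin n) :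
    ∫ ω, (ζ i ω : ℝ) * ζ (finRotate n i) ω ∂P = (p : ℝ) ^ 2 := by
  have : NeZero n := i.neZero
  have hne : i ≠ finRotate n i := by
    rw [finRotate_apply]
    exact Fin.ne_add_one_of_three_le hn i
  have h := integral_prod_finset_of_bernoulli hζ hind {i, finRotate n i}
  rw [Finset.card_pair hne] at h
  rw [← h]
  simp only [Finset.prod_pair hne]

lemma memLp_twoRuns_summand [IsProbabilityMeasure P]
    (hζ : ∀ i, HasLaw (ζ i) (bernoulliMeasure (1 : ℤ) 0 p) P) (i : Fin n) (r : ENNReal) :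
    MemLp (fun ω => (ζ i ω : ℝ) * ζ (finRotate n i) ω) r P := by
  refine MemLp.of_bound ?_ 1 ?_
  · have hm : ∀ k, AEMeasurable (fun ω => (ζ k ω : ℝ)) P := fun k =>
      (measurable_of_countable fun z : ℤ => (z : ℝ)).comp_aemeasurable (hζ k).aemeasurable
    exact ((hm _).mul (hm _)).aestronglyMeasurable
  · filter_upwards [ae_eq_zero_or_one_of_hasLaw_bernoulli (hζ i),
      ae_eq_zero_or_one_of_hasLaw_bernoulli (hζ (finRotate n i))] with ω h h'
    rcases h with h | h <;> rcases h' with h' | h' <;> rw [h, h'] <;> simp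

theorem integral_twoRuns (hn : 3 ≤ n)
    (hζ : ∀ i, HasLaw (ζ i) (bernoulliMeasure (1 : ℤ) 0 p) P) (hind : iIndepFun ζ P) :
    ∫ ω, (twoRuns ζ ω : ℝ) ∂P = n * (p : ℝ) ^ 2 := by
  have := hind.isProbabilityMeasure
  simp only [twoRuns, Int.cast_sum, Int.cast_mul]
  rw [integral_finsetSum _ fun i _ => (memLp_twoRuns_summand hζ i 1).integrable le_rfl]
  simp only [integral_twoRuns_summand hn hζ hind]
  simp

/-- Only equal or adjacent edges of the cycle are correlated: `n` pairs contribute `p² - p⁴` and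
`2n` ordered pairs contribute `p³ - p⁴`. For `n ≥ 3` the edges `i - 1`, `i`, `i + 1` are distinct.
-/
theorem variance_twoRuns (hn : 3 ≤ n)
    (hζ : ∀ i, HasLaw (ζ i) (bernoulliMeasure (1 : ℤ) 0 p) P) (hind : iIndepFun ζ P) :
    variance (fun ω => (twoRuns ζ ω : ℝ)) P
      = n * ((p : ℝ) ^ 2 + 2 * (p : ℝ) ^ 3 - 3 * (p : ℝ) ^ 4) := by
  have := hind.isProbabilityMeasure
  have : NeZero n := ⟨by omega⟩
  have hL := fun i => memLp_twoRuns_summand (P := P) hζ i 2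
  have hm : AEMeasurable (fun ω => (twoRuns ζ ω : ℝ)) P :=
    (measurable_of_countable fun z : ℤ => (z : ℝ)).comp_aemeasurable (aemeasurable_twoRuns hζ)
  rw [← covariance_self hm]
  simp only [twoRuns, Int.cast_sum, Int.cast_mul]
  rw [covariance_fun_sum_fun_sum hL hL]
  have hc : ∀ i j : Fin n, cov[fun ω => (ζ i ω : ℝ) * ζ (finRotate n i) ω,
      fun ω => (ζ j ω : ℝ) * ζ (finRotate n j) ω; P] =
      (if j = i then (p : ℝ) ^ 2 - p ^ 4 else 0) + (if j = i + 1 then (p : ℝ) ^ 3 - p ^ 4 else 0)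
        + (if j = i - 1 then (p : ℝ) ^ 3 - p ^ 4 else 0) := by
    intro i j
    rw [covariance_eq_sub (hL i) (hL j), integral_twoRuns_summand hn hζ hind,
      integral_twoRuns_summand hn hζ hind]
    have e := integral_twoRuns_summand_mul hn hζ hind i j
    simp only [Pi.mul_apply]
    rw [e]
    have h1 : i ≠ i + 1 ∧ i ≠ i - 1 ∧ i + 1 ≠ i - 1 := by
      refine ⟨Fin.ne_add_one_of_three_le hn i, fun h => ?_, fun h => ?_⟩
      · rw [eq_sub_iff_add_eq] at h
        exact Fin.ne_add_one_of_three_le hn i h.symm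
      · rw [eq_sub_iff_add_eq] at h
        exact Fin.ne_add_one_add_one_of_three_le hn i h.symm
    by_cases a : j = i
    · subst a
      simp [h1.1, h1.2.1]
      ring
    by_cases b : j = i + 1
    · subst b
      simp [h1.1.symm, h1.2.2]
      ring
    by_cases c : j = i - 1
    · simp [c, h1.2.1.symm, h1.2.2.symm]
      ring
    · simp [a, b, c]
      ring
  simp only [hc, Finset.sum_add_distrib, Finset.sum_ite_eq', Finset.mem_univ, if_true,
    Finset.sum_const, Finset.card_univ, Fintype.card_fin, nsmul_eq_mul]
  ring

end TwoRuns

/-! ### The transfer matrix: second-order cancellation and contraction -/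

section TransferMatrix

open scoped Matrix.Norms.Operator

/-- The norm in scope is the largest absolute row sum. -/
lemma norm_matrix_fin_two_le {A : Matrix (Fin 2) (Fin 2) ℂ} {c : ℝ}
    (h0 : ‖A 0 0‖ + ‖A 0 1‖ ≤ c) (h1 : ‖A 1 0‖ + ‖A 1 1‖ ≤ c) : ‖A‖ ≤ c := by
  have hc : 0 ≤ c := le_trans (by positivity) h0
  lift c to NNReal using hc
  rw [Matrix.linfty_opNorm_def, NNReal.coe_le_coe]
  refine Finset.sup_le fun i _ => ?_
  rw [← NNReal.coe_le_coe, Fin.sum_univ_two]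
  fin_cases i
  · simpa using h0
  · simpa using h1

lemma norm_trace_fin_two_le (A : Matrix (Fin 2) (Fin 2) ℂ) : ‖A.trace‖ ≤ 2 * ‖A‖ := by
  have h : ∀ i, ‖A i i‖ ≤ ‖A‖ := by
    intro i
    rw [Matrix.linfty_opNorm_def]
    have h1 : ‖A i i‖₊ ≤ ∑ j, ‖A i j‖₊ :=
      Finset.single_le_sum (f := fun j => ‖A i j‖₊) (fun _ _ => zero_le) (Finset.mem_univ i)
    exact_mod_cast h1.trans (Finset.le_sup (f := fun i => ∑ j, ‖A i j‖₊) (Finset.mem_univ i))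
  rw [Matrix.trace_fin_two]
  linarith [norm_add_le (A 0 0) (A 1 1), h 0, h 1]

/-- The derivative of the transfer matrix in the angle, minus the second-order expansion
(in `s = I * t`) of its logarithmic derivative times the matrix itself, up to a factor `I`. -/
noncomputable def transferDefect (p w s : ℂ) : Matrix (Fin 2) (Fin 2) ℂ :=
  !![0, 0; 0, p * w] - (p ^ 2 + (p ^ 2 + 2 * p ^ 3 - 3 * p ^ 4) * s) • transferMatrix p w

/-- The quotient by `x ^ 2` of the compressed defect at `s = x = w - 1`. -/
def transferQuotient (p x : ℂ) : Matrix (Fin 2) (Fin 2) ℂ :=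
  !![(2 * p ^ 3 - 4 * p ^ 4 - 6 * p ^ 5 + 16 * p ^ 6 - 8 * p ^ 7)
      + (p ^ 4 - 3 * p ^ 5 - 4 * p ^ 6 + 10 * p ^ 7 - p ^ 8 - 3 * p ^ 9) * x
      + (-(p ^ 6) - p ^ 7 + 5 * p ^ 8 - 3 * p ^ 9) * x ^ 2,
    (3 * p ^ 4 - 4 * p ^ 5 - 7 * p ^ 6 + 8 * p ^ 7)
      + (p ^ 4 + 2 * p ^ 5 - 7 * p ^ 6 - 9 * p ^ 7 + 10 * p ^ 8 + 3 * p ^ 9) * x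
      + (p ^ 5 - p ^ 6 - 6 * p ^ 7 - 3 * p ^ 8 + 9 * p ^ 9) * x ^ 2
      + (-(p ^ 7) - 2 * p ^ 8 + 3 * p ^ 9) * x ^ 3;
    (3 * p ^ 3 - 7 * p ^ 4 - 3 * p ^ 5 + 15 * p ^ 6 - 8 * p ^ 7)
      + (p ^ 3 + p ^ 4 - 9 * p ^ 5 - 2 * p ^ 6 + 19 * p ^ 7 - 7 * p ^ 8 - 3 * p ^ 9) * x
      + (p ^ 4 - 2 * p ^ 5 - 5 * p ^ 6 + 3 * p ^ 7 + 12 * p ^ 8 - 9 * p ^ 9) * x ^ 2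
      + (-(p ^ 6) - p ^ 7 + 5 * p ^ 8 - 3 * p ^ 9) * x ^ 3,
    (4 * p ^ 4 - 6 * p ^ 5 - 6 * p ^ 6 + 8 * p ^ 7)
      + (2 * p ^ 4 + 5 * p ^ 5 - 16 * p ^ 6 - 10 * p ^ 7 + 16 * p ^ 8 + 3 * p ^ 9) * x
      + (5 * p ^ 5 - 4 * p ^ 6 - 19 * p ^ 7 + 18 * p ^ 9) * x ^ 2
      + (p ^ 5 - 6 * p ^ 7 - 10 * p ^ 8 + 15 * p ^ 9) * x ^ 3
      + (-(p ^ 7) - 2 * p ^ 8 + 3 * p ^ 9) * x ^ 4]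

/-- At `x = 0` the matrix is a projection `Π` of rank one. The constants `p²` and `p² + 2p³ - 3p⁴`
are those of the leading eigenvalue, so the compressed defect loses its terms of order `0` and `1`.
Two factors on each side are needed: with one, a first-order term not of the form `Π · Π` survives
when `0 < p < 1`. On the unit circle `x - s` is itself `O(t²)`. -/
lemma transferMatrix_sq_mul_defect_mul_sq (p x s : ℂ) :
    transferMatrix p (1 + x) ^ 2 * transferDefect p (1 + x) s * transferMatrix p (1 + x) ^ 2 =
      x ^ 2 • transferQuotient p x +
        ((p ^ 2 + 2 * p ^ 3 - 3 * p ^ 4) * (x - s)) • transferMatrix p (1 + x) ^ 5 := by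
  -- The defect is affine in `s`, which reduces to `s = x`, a polynomial identity in `p` and `x`.
  have hs : transferDefect p (1 + x) s = transferDefect p (1 + x) x +
      ((p ^ 2 + 2 * p ^ 3 - 3 * p ^ 4) * (x - s)) • transferMatrix p (1 + x) := by
    simp only [transferDefect]
    module
  have hx : transferMatrix p (1 + x) ^ 2 * transferDefect p (1 + x) x *
      transferMatrix p (1 + x) ^ 2 = x ^ 2 • transferQuotient p x := by
    ext i j
    fin_cases i <;> fin_cases j <;>
    · simp [transferMatrix, transferDefect, transferQuotient, pow_two, Matrix.mul_apply,
        Fin.sum_univ_two]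
      ring
  rw [hs, mul_add, add_mul, hx]
  congr 1
  rw [mul_smul_comm, smul_mul_assoc, ← pow_succ, ← pow_add]

lemma exists_norm_transferQuotient_le (p : ℂ) :
    ∃ C : ℝ, 0 ≤ C ∧ ∀ x : ℂ, ‖x‖ ≤ 2 → ‖transferQuotient p x‖ ≤ C := by
  have hc : Continuous (transferQuotient p) := by
    unfold transferQuotient
    refine continuous_matrix fun i j => ?_
    fin_cases i <;> fin_cases j <;> · simp; fun_prop
  obtain ⟨C, hC⟩ := (isCompact_closedBall (0 : ℂ) 2).exists_bound_of_continuousOn hc.continuousOn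
  refine ⟨C, (norm_nonneg _).trans (hC 0 (by simp)), fun x hx => hC x (by simpa using hx)⟩

lemma norm_exp_ofReal_mul_I_sub_one_le (t : ℝ) : ‖Complex.exp (t * Complex.I) - 1‖ ≤ |t| := by
  rw [mul_comm]
  exact Real.norm_exp_I_mul_ofReal_sub_one_le

lemma norm_exp_ofReal_mul_I_sub_one_sub_le (t : ℝ) :
    ‖Complex.exp (t * Complex.I) - 1 - t * Complex.I‖ ≤ 2 * t ^ 2 := by
  rcases le_total |t| 1 with h | h
  · have := Complex.norm_exp_sub_one_sub_id_le (x := t * Complex.I) (by simpa using h)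
    simp at this
    nlinarith [sq_nonneg t]
  · have h1 := norm_sub_le (Complex.exp (t * Complex.I) - 1) (t * Complex.I)
    have h2 := norm_exp_ofReal_mul_I_sub_one_le t
    have h3 : ‖(t : ℂ) * Complex.I‖ = |t| := by simp
    nlinarith [sq_abs t]

/-- The squared modulus is `1 - 2p(1-p)(1 - cos t)`, at most the square of `1 - p(1-p)(1 - cos t)`;
on `[-π, π]` one has `1 - cos t ≥ 2t²/π²`. -/
lemma norm_one_sub_add_mul_exp_le {p : ℝ} (h0 : 0 ≤ p) (h1 : p ≤ 1) {t : ℝ} (ht : |t| ≤ Real.pi) :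
    ‖(1 - p : ℂ) + p * Complex.exp (t * Complex.I)‖ ≤
      1 - 2 * (p * (1 - p)) / Real.pi ^ 2 * t ^ 2 := by
  have hcos := Real.cos_le_one_sub_mul_cos_sq ht
  have hpq : 0 ≤ p * (1 - p) := mul_nonneg h0 (by linarith)
  have hpq' : p * (1 - p) ≤ 1 / 4 := by nlinarith [sq_nonneg (2 * p - 1)]
  have hc1 := Real.neg_one_le_cos t
  have hle : ‖(1 - p : ℂ) + p * Complex.exp (t * Complex.I)‖ ≤
      1 - p * (1 - p) * (1 - Real.cos t) := by
    refine abs_le_of_sq_le_sq' ?_ ?_ |>.2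
    · rw [← Complex.normSq_eq_norm_sq, Complex.normSq_apply]
      have e1 : ((1 - p : ℂ) + p * Complex.exp (t * Complex.I)).re = 1 - p + p * Real.cos t := by
        simp [Complex.exp_ofReal_mul_I_re, Complex.exp_ofReal_mul_I_im]
      have e2 : ((1 - p : ℂ) + p * Complex.exp (t * Complex.I)).im = p * Real.sin t := by
        simp [Complex.exp_ofReal_mul_I_re, Complex.exp_ofReal_mul_I_im]
      rw [e1, e2]
      nlinarith [Real.sin_sq_add_cos_sq t, sq_nonneg (p * (1 - p) * (1 - Real.cos t))]
    · nlinarith [Real.cos_le_one t]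
  refine hle.trans ?_
  have := mul_le_mul_of_nonneg_left hcos hpq
  have e : 2 * (p * (1 - p)) / Real.pi ^ 2 * t ^ 2 = p * (1 - p) * (2 / Real.pi ^ 2 * t ^ 2) := by
    ring
  rw [e]
  linarith

lemma norm_transferMatrix_le_one {p : ℝ} (h0 : 0 ≤ p) (h1 : p ≤ 1) (t : ℝ) :
    ‖transferMatrix p (Complex.exp (t * Complex.I))‖ ≤ 1 := by
  have e1 : ‖(1 - p : ℂ)‖ = 1 - p := by
    rw [← Complex.ofReal_one, ← Complex.ofReal_sub, Complex.norm_of_nonneg (by linarith)]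
  apply norm_matrix_fin_two_le <;> simp [transferMatrix, e1, abs_of_nonneg h0]

/-- The absolute row sums of the matrix equal `1` for every `t`, so one step gains nothing. In the
square, the off-diagonal entries add two paths with different phases and carry the factor `1 - p + p
w`. -/
lemma norm_transferMatrix_sq_le {p : ℝ} (h0 : 0 ≤ p) (h1 : p ≤ 1) {t : ℝ} (ht : |t| ≤ Real.pi) :
    ‖transferMatrix p (Complex.exp (t * Complex.I)) ^ 2‖ ≤
      Real.exp (-(2 * (p * (1 - p)) ^ 2 / Real.pi ^ 2 * t ^ 2)) := by
  set w := Complex.exp (t * Complex.I) with hw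
  have e1 : ‖(1 - p : ℂ)‖ = 1 - p := by
    rw [← Complex.ofReal_one, ← Complex.ofReal_sub, Complex.norm_of_nonneg (by linarith)]
  have e2 : ‖(p : ℂ)‖ = p := Complex.norm_of_nonneg h0
  have e3 : ‖w‖ = 1 := Complex.norm_exp_ofReal_mul_I t
  have hr := norm_one_sub_add_mul_exp_le h0 h1 ht
  rw [← hw] at hr
  set r := ‖(1 - p : ℂ) + p * w‖
  set d := t ^ 2 / Real.pi ^ 2 with hd
  have hd0 : 0 ≤ d := by positivity
  have hr' : 2 * (p * (1 - p)) * d ≤ 1 - r := by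
    have : 2 * (p * (1 - p)) / Real.pi ^ 2 * t ^ 2 = 2 * (p * (1 - p)) * d := by rw [hd]; ring
    linarith
  have hq : 0 ≤ 1 - p := by linarith
  have hpq : 0 ≤ p * (1 - p) := mul_nonneg h0 hq
  have hr0 : 0 ≤ 1 - r := le_trans (by positivity) hr'
  have key : 2 * (p * (1 - p)) ^ 2 * d ≤ p * (1 - p) * (1 - r) := by nlinarith
  have hexp : 1 - p * (1 - p) * (1 - r) ≤
      Real.exp (-(2 * (p * (1 - p)) ^ 2 / Real.pi ^ 2 * t ^ 2)) := by
    have : 2 * (p * (1 - p)) ^ 2 / Real.pi ^ 2 * t ^ 2 = 2 * (p * (1 - p)) ^ 2 * d := by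
      rw [hd]; ring
    rw [this]
    linarith [Real.add_one_le_exp (-(2 * (p * (1 - p)) ^ 2 * d))]
  refine le_trans (norm_matrix_fin_two_le (c := 1 - p * (1 - p) * (1 - r)) ?_ ?_) hexp
  · have a : (transferMatrix p w ^ 2) 0 0 = (1 - p : ℂ) := by
      simp [transferMatrix, pow_two, Matrix.mul_apply, Fin.sum_univ_two]; ring
    have b : (transferMatrix p w ^ 2) 0 1 = p * ((1 - p : ℂ) + p * w) := by
      simp [transferMatrix, pow_two, Matrix.mul_apply, Fin.sum_univ_two]; ring
    rw [a, b, norm_mul, e1, e2]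
    nlinarith [mul_nonneg h0 hr0, mul_nonneg (mul_nonneg h0 hr0) h0]
  · have a : (transferMatrix p w ^ 2) 1 0 = (1 - p : ℂ) * ((1 - p : ℂ) + p * w) := by
      simp [transferMatrix, pow_two, Matrix.mul_apply, Fin.sum_univ_two]; ring
    have b : (transferMatrix p w ^ 2) 1 1 = p * ((1 - p : ℂ) + p * w ^ 2) := by
      simp [transferMatrix, pow_two, Matrix.mul_apply, Fin.sum_univ_two]; ring
    have c : ‖(1 - p : ℂ) + p * w ^ 2‖ ≤ 1 := by
      refine (norm_add_le _ _).trans ?_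
      rw [norm_mul, norm_pow, e1, e2, e3]
      linarith
    rw [a, b, norm_mul, norm_mul, e1, e2]
    nlinarith [mul_nonneg hq hr0, mul_nonneg (mul_nonneg hq hr0) hq,
      mul_le_mul_of_nonneg_left c h0]

lemma norm_transferMatrix_pow_le {p : ℝ} (h0 : 0 ≤ p) (h1 : p ≤ 1) {t : ℝ} (ht : |t| ≤ Real.pi)
    (k : ℕ) :
    ‖transferMatrix p (Complex.exp (t * Complex.I)) ^ k‖ ≤
      Real.exp (-(2 * (p * (1 - p)) ^ 2 / Real.pi ^ 2 * (k / 2 : ℕ) * t ^ 2)) := by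
  set A := transferMatrix p (Complex.exp (t * Complex.I))
  have hsq : ∀ j : ℕ, ‖(A ^ 2) ^ j‖ ≤
      Real.exp (-(2 * (p * (1 - p)) ^ 2 / Real.pi ^ 2 * j * t ^ 2)) := by
    intro j
    rcases Nat.eq_zero_or_pos j with rfl | hj
    · simp
    refine (norm_pow_le' _ hj).trans ?_
    refine (pow_le_pow_left₀ (norm_nonneg _) (norm_transferMatrix_sq_le h0 h1 ht) j).trans ?_
    rw [← Real.exp_nat_mul]
    apply le_of_eq
    congr 1
    ring
  have h2 : ‖A ^ (k % 2)‖ ≤ 1 := by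
    rcases Nat.mod_two_eq_zero_or_one k with h | h <;> rw [h]
    · simp
    · simpa using norm_transferMatrix_le_one h0 h1 t
  have hk : A ^ k = (A ^ 2) ^ (k / 2) * A ^ (k % 2) := by
    rw [← pow_mul, ← pow_add, Nat.div_add_mod]
  rw [hk]
  refine (norm_mul_le _ _).trans ?_
  calc _ ≤ ‖(A ^ 2) ^ (k / 2)‖ * 1 := mul_le_mul_of_nonneg_left h2 (norm_nonneg _)
    _ ≤ _ := by rw [mul_one]; exact hsq _

end TransferMatrix

/-! ### The approximate Gaussian differential equation -/

section CharacteristicFunction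

open scoped Matrix.Norms.Operator

/-- The product rule gives `n` terms, all equal by cyclicity of the trace. -/
lemma hasDerivAt_trace_pow {A : ℝ → Matrix (Fin 2) (Fin 2) ℂ} {A' : Matrix (Fin 2) (Fin 2) ℂ}
    {t : ℝ} (h : HasDerivAt A A' t) (n : ℕ) :
    HasDerivAt (fun s => (A s ^ n).trace) (n * (A' * A t ^ (n - 1)).trace) t := by
  let L : Matrix (Fin 2) (Fin 2) ℂ →L[ℝ] ℂ :=
    LinearMap.toContinuousLinearMap (Matrix.traceLinearMap (Fin 2) ℝ ℂ)
  have h1 := L.hasFDerivAt.comp_hasDerivAt t (h.fun_pow' n)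
  refine h1.congr_deriv ?_
  change (∑ i ∈ Finset.range n, A t ^ (n.pred - i) * A' * A t ^ i).trace = _
  rw [Matrix.trace_sum, ← nsmul_eq_mul]
  conv_rhs => rw [← Finset.card_range n, ← Finset.sum_const]
  refine Finset.sum_congr rfl fun i hi => ?_
  rw [Matrix.trace_mul_comm, ← mul_assoc, ← pow_add, Matrix.trace_mul_comm]
  congr 3
  have := Finset.mem_range.1 hi
  simp only [Finset.card_range, Nat.pred_eq_sub_one]
  omega

lemma hasDerivAt_transferMatrix (p : ℂ) (t : ℝ) :
    HasDerivAt (fun s : ℝ => transferMatrix p (Complex.exp (s * Complex.I)))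
      (Complex.I • !![0, 0; 0, p * Complex.exp (t * Complex.I)]) t := by
  have h : ∀ w : ℂ, transferMatrix p w = !![1 - p, p; 1 - p, 0] + w • !![0, 0; 0, p] := by
    intro w
    ext i j
    fin_cases i <;> fin_cases j <;> simp [transferMatrix, mul_comm]
  simp only [h]
  have he : HasDerivAt (fun s : ℝ => Complex.exp (s * Complex.I))
      (Complex.exp (t * Complex.I) * Complex.I) t := by
    have := ((Complex.ofRealCLM.hasDerivAt (x := t)).mul_const Complex.I).cexp
    simpa using this
  refine ((he.smul_const (!![0, 0; 0, p] : Matrix (Fin 2) (Fin 2) ℂ)).const_add _).congr_deriv ?_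
  ext i j
  fin_cases i <;> fin_cases j <;> simp
  ring

/-- The centred characteristic function of the 2-runs statistic. -/
noncomputable def centredCF (p : ℝ) (n : ℕ) (t : ℝ) : ℂ :=
  Complex.exp (-(n * p ^ 2 * t * Complex.I)) *
    (transferMatrix p (Complex.exp (t * Complex.I)) ^ n).trace

/-- The defect of `centredCF` from satisfying the differential equation of a Gaussian
characteristic function. -/
noncomputable def centredCFDefect (p : ℝ) (n : ℕ) (t : ℝ) : ℂ :=
  n * Complex.I * Complex.exp (-(n * p ^ 2 * t * Complex.I)) *
    (transferDefect p (Complex.exp (t * Complex.I)) (t * Complex.I) *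
      transferMatrix p (Complex.exp (t * Complex.I)) ^ (n - 1)).trace

/-- With `s = i t`, the part of the logarithmic derivative removed in the defect is `i (p² + v s) =
i p² - v t`: centring cancels the first term and the second is the Gaussian drift. -/
lemma hasDerivAt_centredCF (p : ℝ) {n : ℕ} (hn : n ≠ 0) (t : ℝ) :
    HasDerivAt (centredCF p n)
      (-(n * (p ^ 2 + 2 * p ^ 3 - 3 * p ^ 4) * t : ℝ) * centredCF p n t + centredCFDefect p n t)
      t := by
  have h1 := hasDerivAt_trace_pow (hasDerivAt_transferMatrix p t) n
  have h2 : HasDerivAt (fun s : ℝ => Complex.exp (-(n * p ^ 2 * s * Complex.I)))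
      (Complex.exp (-(n * p ^ 2 * t * Complex.I)) * -(n * p ^ 2 * Complex.I)) t := by
    have := (((Complex.ofRealCLM.hasDerivAt (x := t)).const_mul
      ((n : ℂ) * p ^ 2)).mul_const Complex.I).neg.cexp
    simpa using this
  refine (h2.mul h1).congr_deriv ?_
  obtain ⟨m, rfl⟩ := Nat.exists_eq_succ_of_ne_zero hn
  simp only [centredCF, centredCFDefect, transferDefect, sub_mul, smul_mul_assoc, Matrix.trace_sub,
    Matrix.trace_smul, Nat.succ_eq_add_one, Nat.add_sub_cancel, smul_eq_mul, ← pow_succ']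
  push_cast
  have hI : Complex.I ^ 2 = -1 := Complex.I_sq
  linear_combination (Complex.exp (-((m + 1) * p ^ 2 * t * Complex.I)) * (m + 1) * t *
    (p ^ 2 + 2 * p ^ 3 - 3 * p ^ 4) *
    (transferMatrix p (Complex.exp (t * Complex.I)) ^ (m + 1)).trace) * hI

lemma continuous_centredCFDefect (p : ℝ) (n : ℕ) : Continuous (centredCFDefect p n) := by
  have h1 : Continuous fun t : ℝ => transferMatrix p (Complex.exp (t * Complex.I)) :=
    continuous_iff_continuousAt.2 fun t => (hasDerivAt_transferMatrix p t).continuousAt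
  have h2 : Continuous fun t : ℝ => (!![0, 0; 0, p * Complex.exp (t * Complex.I)] :
      Matrix (Fin 2) (Fin 2) ℂ) := by
    refine continuous_matrix fun i j => ?_
    fin_cases i <;> fin_cases j <;> · simp; fun_prop
  unfold centredCFDefect transferDefect
  refine Continuous.mul (by fun_prop) (Continuous.matrix_trace ?_)
  have h3 : Continuous fun t : ℝ =>
      (p : ℂ) ^ 2 + ((p : ℂ) ^ 2 + 2 * p ^ 3 - 3 * p ^ 4) * (t * Complex.I) := by fun_prop
  exact (h2.sub (h3.smul h1)).mul (h1.pow _)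

lemma centredCF_zero (p : ℝ) {n : ℕ} (hn : n ≠ 0) : centredCF p n 0 = 1 := by
  -- At `w = 1` the matrix is stochastic with equal rows, hence idempotent, and has trace `1`.
  have h : IsIdempotentElem (transferMatrix p 1) := by
    ext i j
    fin_cases i <;> fin_cases j <;>
    · simp [transferMatrix, Matrix.mul_apply, Fin.sum_univ_two]
      ring
  simp only [centredCF, Complex.ofReal_zero, zero_mul, mul_zero, neg_zero, Complex.exp_zero]
  rw [h.pow_eq hn]
  simp [transferMatrix, Matrix.trace_fin_two]

lemma exists_norm_centredCFDefect_le {p : ℝ} (h0 : 0 ≤ p) (h1 : p ≤ 1) :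
    ∃ C : ℝ, 0 ≤ C ∧ ∀ n : ℕ, 7 ≤ n → ∀ t : ℝ, |t| ≤ Real.pi →
      ‖centredCFDefect p n t‖ ≤
        C * n * t ^ 2 * Real.exp (-((p * (1 - p)) ^ 2 / (7 * Real.pi ^ 2) * n * t ^ 2)) := by
  obtain ⟨C, hC0, hC⟩ := exists_norm_transferQuotient_le p
  set v := ‖((p : ℂ) ^ 2 + 2 * p ^ 3 - 3 * p ^ 4)‖ with hv
  refine ⟨2 * (C + v * 2), by positivity, fun n hn t ht => ?_⟩
  set w := Complex.exp (t * Complex.I) with hw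
  -- Four of the `n - 1` factors are moved cyclically around the defect, two to each side; `n - 5`
  -- remain to provide decay.
  have htr : (transferDefect p w (t * Complex.I) * transferMatrix p w ^ (n - 1)).trace =
      (transferMatrix p w ^ 2 * transferDefect p w (t * Complex.I) * transferMatrix p w ^ 2 *
        transferMatrix p w ^ (n - 5)).trace := by
    rw [mul_assoc, mul_assoc, Matrix.trace_mul_comm (transferMatrix p w ^ 2), mul_assoc, ← pow_add,
      ← pow_add]
    congr 4
    omega
  have hM1 := norm_transferMatrix_le_one h0 h1 t
  rw [← hw] at hM1
  have hx : ‖w - 1‖ ≤ |t| := norm_exp_ofReal_mul_I_sub_one_le t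
  have hx2 : ‖w - 1‖ ≤ 2 := by
    refine (norm_sub_le _ _).trans ?_
    rw [hw, Complex.norm_exp_ofReal_mul_I]
    norm_num
  have hmain : ‖transferMatrix p w ^ 2 * transferDefect p w (t * Complex.I) *
      transferMatrix p w ^ 2‖ ≤ (C + v * 2) * t ^ 2 := by
    have := transferMatrix_sq_mul_defect_mul_sq p (w - 1) (t * Complex.I)
    rw [add_sub_cancel] at this
    rw [this]
    refine (norm_add_le _ _).trans ?_
    rw [norm_smul, norm_smul, norm_mul, norm_pow, ← hv, add_mul]
    refine add_le_add ?_ ?_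
    · rw [mul_comm C, ← sq_abs t]
      exact mul_le_mul (pow_le_pow_left₀ (norm_nonneg _) hx 2) (hC _ hx2) (norm_nonneg _)
        (sq_nonneg _)
    · have h5 : ‖transferMatrix p w ^ 5‖ ≤ 1 :=
        (norm_pow_le' _ (by norm_num)).trans (pow_le_one₀ (norm_nonneg _) hM1)
      calc _ ≤ v * (2 * t ^ 2) * 1 :=
            mul_le_mul (mul_le_mul_of_nonneg_left (norm_exp_ofReal_mul_I_sub_one_sub_le t)
              (norm_nonneg _)) h5 (norm_nonneg _) (by positivity)
        _ = _ := by ring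
  have hdecay : ‖transferMatrix p w ^ (n - 5)‖ ≤
      Real.exp (-((p * (1 - p)) ^ 2 / (7 * Real.pi ^ 2) * n * t ^ 2)) := by
    refine (norm_transferMatrix_pow_le h0 h1 ht (n - 5)).trans (Real.exp_le_exp.2 ?_)
    -- This needs `n ≥ 7`: for `n = 6` the single remaining factor gives no contraction. The `14`
    -- turns the rate `2 / π²` into `1 / (7π²)`.
    have h14 : (n : ℝ) ≤ 14 * ((n - 5) / 2 : ℕ) := by
      have : n ≤ 14 * ((n - 5) / 2) := by omega
      exact_mod_cast this
    have e1 : (p * (1 - p)) ^ 2 / (7 * Real.pi ^ 2) * n * t ^ 2 =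
      2 * (p * (1 - p)) ^ 2 / Real.pi ^ 2 * t ^ 2 / 14 * n := by
      field_simp
      ring
    have e2 := mul_le_mul_of_nonneg_left h14
      (show 0 ≤ 2 * (p * (1 - p)) ^ 2 / Real.pi ^ 2 * t ^ 2 / 14 by positivity)
    rw [e1]
    linarith
  have hexp : ‖Complex.exp (-(n * p ^ 2 * t * Complex.I))‖ = 1 := by
    rw [Complex.norm_exp]
    simp [← Complex.ofReal_pow]
  rw [centredCFDefect, ← hw, htr, norm_mul, norm_mul, norm_mul, hexp, Complex.norm_I,
    Complex.norm_natCast, mul_one, mul_one]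
  calc _ ≤ (n : ℝ) * (2 * ((C + v * 2) * t ^ 2 *
        Real.exp (-((p * (1 - p)) ^ 2 / (7 * Real.pi ^ 2) * n * t ^ 2)))) := by
        refine mul_le_mul_of_nonneg_left ((norm_trace_fin_two_le _).trans ?_) (Nat.cast_nonneg _)
        refine mul_le_mul_of_nonneg_left ((norm_mul_le _ _).trans ?_) zero_le_two
        exact mul_le_mul hmain hdecay (norm_nonneg _) (by positivity)
    _ = _ := by ring

end CharacteristicFunction

/-! ### From the differential equation to Gaussian bounds -/

section GaussianComparison

/-- The integrating factor `exp (s t²/2)` leaves only `R` in the derivative, and the mean value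
inequality applies. Because `k ≤ s/2`, the resulting bound grows with `|u|`, so its value at `t`
serves on all of `[-|t|, |t|]`. -/
lemma norm_sub_gaussian_le {ψ R : ℝ → ℂ} {s k B : ℝ} (hk : k ≤ s / 2) (hB : 0 ≤ B)
    (hψ : ∀ t, HasDerivAt ψ (-(s * t : ℝ) * ψ t + R t) t) (h0 : ψ 0 = 1)
    (hR : ∀ t, |t| ≤ Real.pi → ‖R t‖ ≤ B * t ^ 2 * Real.exp (-(k * t ^ 2)))
    {t : ℝ} (ht : |t| ≤ Real.pi) :
    ‖ψ t - Real.exp (-(s / 2 * t ^ 2))‖ ≤ B * |t| ^ 3 * Real.exp (-(k * t ^ 2)) := by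
  have hd : ∀ u : ℝ, HasDerivAt (fun u : ℝ => ψ u * (Real.exp (s / 2 * u ^ 2) : ℂ))
      (R u * (Real.exp (s / 2 * u ^ 2) : ℂ)) u := by
    intro u
    have he : HasDerivAt (fun u : ℝ => Real.exp (s / 2 * u ^ 2))
        (Real.exp (s / 2 * u ^ 2) * (s * u)) u := by
      refine (((hasDerivAt_pow 2 u).const_mul (s / 2)).exp).congr_deriv ?_
      norm_num
      ring
    refine ((hψ u).mul he.ofReal_comp).congr_deriv ?_
    push_cast
    ring
  have hbound : ∀ u ∈ Set.Icc (-|t|) |t|, ‖R u * (Real.exp (s / 2 * u ^ 2) : ℂ)‖ ≤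
      B * t ^ 2 * Real.exp ((s / 2 - k) * t ^ 2) := by
    intro u hu
    have hut : |u| ≤ |t| := abs_le.2 hu
    have hut2 : u ^ 2 ≤ t ^ 2 := sq_le_sq.2 hut
    rw [norm_mul, Complex.norm_of_nonneg (Real.exp_pos _).le]
    calc _ ≤ B * u ^ 2 * Real.exp (-(k * u ^ 2)) * Real.exp (s / 2 * u ^ 2) :=
          mul_le_mul_of_nonneg_right (hR u (hut.trans ht)) (Real.exp_pos _).le
      _ = B * u ^ 2 * Real.exp ((s / 2 - k) * u ^ 2) := by
          rw [mul_assoc, ← Real.exp_add]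
          congr 2
          ring
      _ ≤ _ := by
          have : 0 ≤ s / 2 - k := by linarith
          gcongr
  have hmv := (convex_Icc (-|t|) |t|).norm_image_sub_le_of_norm_hasDerivWithin_le
    (fun u _ => (hd u).hasDerivWithinAt) hbound (x := 0) (y := t) (by simp)
    ⟨neg_abs_le t, le_abs_self t⟩
  have hmul : ψ t - Real.exp (-(s / 2 * t ^ 2)) =
      (ψ t * (Real.exp (s / 2 * t ^ 2) : ℂ) - ψ 0 * (Real.exp (s / 2 * 0 ^ 2) : ℂ)) *
        (Real.exp (-(s / 2 * t ^ 2)) : ℂ) := by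
    have : (Real.exp (s / 2 * t ^ 2) : ℂ) * (Real.exp (-(s / 2 * t ^ 2)) : ℂ) = 1 := by
      rw [← Complex.ofReal_mul, ← Real.exp_add]
      simp
    rw [sub_mul, mul_assoc, this, h0]
    simp
  rw [hmul, norm_mul, Complex.norm_of_nonneg (Real.exp_pos _).le]
  refine (mul_le_mul_of_nonneg_right hmv (Real.exp_pos _).le).trans (le_of_eq ?_)
  rw [sub_zero, Real.norm_eq_abs]
  have e1 : Real.exp (-(k * t ^ 2)) =
      Real.exp ((s / 2 - k) * t ^ 2) * Real.exp (-(s / 2 * t ^ 2)) := by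
    rw [← Real.exp_add]
    congr 1
    ring
  rw [e1, ← sq_abs t]
  ring

lemma hasDerivAt_sub_gaussian {ψ R : ℝ → ℂ} {s : ℝ}
    (hψ : ∀ t, HasDerivAt ψ (-(s * t : ℝ) * ψ t + R t) t) (t : ℝ) :
    HasDerivAt (fun t => ψ t - (Real.exp (-(s / 2 * t ^ 2)) : ℂ))
      (-(s * t : ℝ) * (ψ t - (Real.exp (-(s / 2 * t ^ 2)) : ℂ)) + R t) t := by
  have he : HasDerivAt (fun u : ℝ => Real.exp (-(s / 2 * u ^ 2)))
      (Real.exp (-(s / 2 * t ^ 2)) * -(s * t)) t := by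
    refine (((hasDerivAt_pow 2 t).const_mul (s / 2)).neg.exp).congr_deriv ?_
    norm_num
    ring
  refine ((hψ t).sub he.ofReal_comp).congr_deriv ?_
  push_cast
  ring

lemma norm_deriv_sub_gaussian_le {ψ R : ℝ → ℂ} {s k B : ℝ} (hs : 0 ≤ s) (hk : k ≤ s / 2)
    (hB : 0 ≤ B) (hψ : ∀ t, HasDerivAt ψ (-(s * t : ℝ) * ψ t + R t) t) (h0 : ψ 0 = 1)
    (hR : ∀ t, |t| ≤ Real.pi → ‖R t‖ ≤ B * t ^ 2 * Real.exp (-(k * t ^ 2)))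
    {t : ℝ} (ht : |t| ≤ Real.pi) :
    ‖-(s * t : ℝ) * (ψ t - (Real.exp (-(s / 2 * t ^ 2)) : ℂ)) + R t‖ ≤
      B * (t ^ 2 + s * t ^ 4) * Real.exp (-(k * t ^ 2)) := by
  refine (norm_add_le _ _).trans ?_
  rw [norm_mul, norm_neg, Complex.norm_real, Real.norm_eq_abs, abs_mul, abs_of_nonneg hs]
  have h1 := mul_le_mul_of_nonneg_left (norm_sub_gaussian_le hk hB hψ h0 hR ht)
    (show 0 ≤ s * |t| by positivity)
  have h2 := hR t ht
  have h4 : |t| ^ 4 = t ^ 4 := by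
    rw [← abs_pow, abs_of_nonneg (by positivity)]
  calc _ ≤ _ := add_le_add h1 h2
    _ = B * (t ^ 2 + s * |t| ^ 4) * Real.exp (-(k * t ^ 2)) := by ring
    _ = _ := by rw [h4]

end GaussianComparison

/-! ### Parseval and integration by parts on `[-π, π]` -/

section Fourier

lemma sum_sq_norm_fourier_integral_le {f : ℝ → ℂ} (hf : Continuous f) (W : Finset ℤ) :
    ∑ z ∈ W, ‖∫ t in -Real.pi..Real.pi, Complex.exp (-(z * t * Complex.I)) * f t‖ ^ 2 ≤
      2 * Real.pi * ∫ t in -Real.pi..Real.pi, ‖f t‖ ^ 2 := by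
  have hab : -Real.pi < Real.pi := by linarith [Real.pi_pos]
  have hpi := Real.pi_pos
  have hL2 : MemLp f 2 (volume.restrict (Set.Ioc (-Real.pi) Real.pi)) := by
    obtain ⟨C, hC⟩ := (isCompact_Icc (a := -Real.pi) (b := Real.pi)).exists_bound_of_continuousOn
      hf.continuousOn
    refine MemLp.of_bound hf.aestronglyMeasurable C ?_
    filter_upwards [ae_restrict_mem measurableSet_Ioc] with t ht
    exact hC t (Set.Ioc_subset_Icc_self ht)
  have hsum := hasSum_sq_fourierCoeffOn hab hL2
  have hc : ∀ z : ℤ, fourierCoeffOn hab f z = (1 / (2 * Real.pi) : ℝ) •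
      ∫ t in -Real.pi..Real.pi, Complex.exp (-(z * t * Complex.I)) * f t := by
    intro z
    rw [fourierCoeffOn_eq_integral, sub_neg_eq_add, ← two_mul]
    congr 1
    refine intervalIntegral.integral_congr fun t _ => ?_
    simp only [fourier_coe_apply, smul_eq_mul]
    congr 2
    push_cast
    have : (Real.pi : ℂ) ≠ 0 := by exact_mod_cast hpi.ne'
    field_simp
  have hle := sum_le_hasSum W (fun z _ => sq_nonneg _) hsum
  simp only [hc, norm_smul, mul_pow] at hle
  rw [← Finset.mul_sum, sub_neg_eq_add, ← two_mul, smul_eq_mul, Real.norm_of_nonneg (by positivity)]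
    at hle
  have h2 := mul_le_mul_of_nonneg_left hle (show 0 ≤ (2 * Real.pi) ^ 2 by positivity)
  have e1 : ∀ x : ℝ, (2 * Real.pi) ^ 2 * ((1 / (2 * Real.pi)) ^ 2 * x) = x := by
    intro x; field_simp
  have e2 : ∀ x : ℝ, (2 * Real.pi) ^ 2 * ((2 * Real.pi)⁻¹ * x) = 2 * Real.pi * x := by
    intro x; field_simp
  rwa [e1, e2] at h2

/-- A non-integer shift `μ` is a unimodular factor, absorbed into `f`. -/
lemma sum_sq_norm_fourier_integral_sub_le {f : ℝ → ℂ} (hf : Continuous f) (W : Finset ℤ) (μ : ℝ) :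
    ∑ z ∈ W, ‖∫ t in -Real.pi..Real.pi, Complex.exp (-((z - μ) * t * Complex.I)) * f t‖ ^ 2 ≤
      2 * Real.pi * ∫ t in -Real.pi..Real.pi, ‖f t‖ ^ 2 := by
  have h := sum_sq_norm_fourier_integral_le
    (f := fun t => Complex.exp (μ * t * Complex.I) * f t) (by fun_prop) W
  have e : ∀ t : ℝ, ‖Complex.exp (μ * t * Complex.I) * f t‖ = ‖f t‖ := by
    intro t
    rw [norm_mul, ← Complex.ofReal_mul, Complex.norm_exp_ofReal_mul_I, one_mul]
  simp only [e, ← mul_assoc, ← Complex.exp_add] at h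
  convert h using 8
  ring

/-- Integration by parts. The boundary terms stay because neither `f` nor the phase, for real `a`,
need be `2π`-periodic. -/
lemma abs_mul_norm_fourier_integral_le {f f' : ℝ → ℂ} (hf : ∀ t, HasDerivAt f (f' t) t)
    (hf' : Continuous f') (a : ℝ) :
    |a| * ‖∫ t in -Real.pi..Real.pi, Complex.exp (-(a * t * Complex.I)) * f t‖ ≤
      ‖∫ t in -Real.pi..Real.pi, Complex.exp (-(a * t * Complex.I)) * f' t‖ +
        (‖f Real.pi‖ + ‖f (-Real.pi)‖) := by
  have hfc : Continuous f := continuous_iff_continuousAt.2 fun t => (hf t).continuousAt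
  have he : ∀ t : ℝ, HasDerivAt (fun t : ℝ => Complex.exp (-(a * t * Complex.I)))
      (Complex.exp (-(a * t * Complex.I)) * -(a * Complex.I)) t := by
    intro t
    have := (((Complex.ofRealCLM.hasDerivAt (x := t)).const_mul
      (a : ℂ)).mul_const Complex.I).neg.cexp
    simpa using this
  have hn : ∀ t : ℝ, ‖Complex.exp (-(a * t * Complex.I))‖ = 1 := by
    intro t
    rw [Complex.norm_exp]
    simp
  have hint := intervalIntegral.integral_eq_sub_of_hasDerivAt (a := -Real.pi) (b := Real.pi)
    (fun t _ => (he t).mul (hf t)) (Continuous.intervalIntegrable (by fun_prop) _ _)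
  rw [intervalIntegral.integral_add (Continuous.intervalIntegrable (by fun_prop) _ _)
    (Continuous.intervalIntegrable (by fun_prop) _ _)] at hint
  have e1 : ∫ t in -Real.pi..Real.pi, Complex.exp (-(a * t * Complex.I)) * -(a * Complex.I) * f t =
      -(a * Complex.I) * ∫ t in -Real.pi..Real.pi, Complex.exp (-(a * t * Complex.I)) * f t := by
    rw [← intervalIntegral.integral_const_mul]
    refine intervalIntegral.integral_congr fun t _ => ?_
    ring
  rw [e1] at hint
  have e2 : |a| * ‖∫ t in -Real.pi..Real.pi, Complex.exp (-(a * t * Complex.I)) * f t‖ =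
      ‖-(a * Complex.I) * ∫ t in -Real.pi..Real.pi, Complex.exp (-(a * t * Complex.I)) * f t‖ := by
    simp
  rw [e2, eq_sub_of_add_eq hint, sub_eq_add_neg, add_comm]
  refine (norm_add_le _ _).trans (add_le_add (le_of_eq (norm_neg _)) ?_)
  refine (norm_sub_le _ _).trans (le_of_eq ?_)
  simp only [Pi.mul_apply, norm_mul, hn, one_mul]

end Fourier

/-! ### Sums over integers against integrals, and the `ℓ¹` bound -/

section IntegerSums

lemma sum_setIntegral_unit_le_integral {g : ℝ → ℝ} (hg : Integrable g) (h0 : ∀ y, 0 ≤ g y)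
    (W : Finset ℤ) :
    ∑ z ∈ W, ∫ y in Set.Ico ((z : ℝ) - 1 / 2) ((z : ℝ) + 1 / 2), g y ≤ ∫ y, g y := by
  rw [← integral_biUnion_finset W (fun _ _ => measurableSet_Ico) ?_ fun _ _ => hg.integrableOn]
  · exact setIntegral_le_integral hg (.of_forall h0)
  · intro i _ j _ hij
    refine Set.disjoint_left.2 fun y hy hy' => hij ?_
    simp only [Set.mem_Ico] at hy hy'
    have h1 : (i : ℝ) < j + 1 := by linarith
    have h2 : (j : ℝ) < i + 1 := by linarith
    norm_cast at h1 h2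
    omega

/-- Comparison with the integral of a Cauchy profile of width `√N`. As `N ≥ 1`, the profile varies
by at most a factor `3` in the direction needed over half a unit. -/
lemma sum_inv_one_add_sq_le (W : Finset ℤ) (μ : ℝ) {N : ℝ} (hN : 1 ≤ N) :
    ∑ z ∈ W, (1 + ((z : ℝ) - μ) ^ 2 / N)⁻¹ ≤ 3 * Real.pi * √N := by
  have hs : 0 < √N := Real.sqrt_pos.2 (by linarith)
  set g : ℝ → ℝ := fun y => (1 + ((y - μ) / √N) ^ 2)⁻¹ with hgdef
  have hg : Integrable g := by
    have h := (integrable_inv_one_add_sq.comp_div hs.ne').comp_sub_right μ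
    simpa using h
  have hgint : ∫ y, g y = √N * Real.pi := by
    rw [hgdef, integral_sub_right_eq_self (fun y => (1 + (y / √N) ^ 2)⁻¹) μ,
      Measure.integral_comp_div (fun y => (1 + y ^ 2)⁻¹), integral_univ_inv_one_add_sq,
      abs_of_pos hs, smul_eq_mul]
  have hterm : ∀ z ∈ W, (1 + ((z : ℝ) - μ) ^ 2 / N)⁻¹ ≤
      3 * ∫ y in Set.Ico ((z : ℝ) - 1 / 2) ((z : ℝ) + 1 / 2), g y := by
    intro z _
    have hle : ∀ y ∈ Set.Ico ((z : ℝ) - 1 / 2) ((z : ℝ) + 1 / 2),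
        (1 + ((z : ℝ) - μ) ^ 2 / N)⁻¹ / 3 ≤ g y := by
      intro y hy
      simp only [hgdef, div_pow, Real.sq_sqrt (show 0 ≤ N by linarith)]
      rw [div_eq_mul_inv, ← mul_inv]
      refine inv_anti₀ (by positivity) ?_
      have h1 : (y - μ) ^ 2 ≤ 2 * ((z : ℝ) - μ) ^ 2 + 1 := by
        have : (y - z) ^ 2 ≤ 1 / 4 := by
          obtain ⟨a, b⟩ := hy
          nlinarith
        nlinarith [sq_nonneg (z - μ - (y - z))]
      have h2 : (y - μ) ^ 2 / N ≤ 2 * (((z : ℝ) - μ) ^ 2 / N) + 1 := by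
        rw [div_le_iff₀ (by linarith)]
        have : (2 * (((z : ℝ) - μ) ^ 2 / N) + 1) * N = 2 * ((z : ℝ) - μ) ^ 2 + N := by
          field_simp
        linarith
      have h3 : 0 ≤ ((z : ℝ) - μ) ^ 2 / N := by positivity
      linarith
    have h := setIntegral_mono_on (μ := volume) (integrableOn_const (by simp) (by simp))
      hg.integrableOn measurableSet_Ico hle
    rw [setIntegral_const, measureReal_def, Real.volume_Ico] at h
    norm_num at h
    norm_num
    linarith
  calc _ ≤ ∑ z ∈ W, 3 * ∫ y in Set.Ico ((z : ℝ) - 1 / 2) ((z : ℝ) + 1 / 2), g y :=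
        Finset.sum_le_sum hterm
    _ ≤ 3 * ∫ y, g y := by
        rw [← Finset.mul_sum]
        exact mul_le_mul_of_nonneg_left
          (sum_setIntegral_unit_le_integral hg (fun y => by positivity) W) (by norm_num)
    _ = _ := by rw [hgint]; ring

end IntegerSums

/-- An `ℓ¹` bound for Fourier coefficients in terms of `L²` norms of the function and of its
derivative. -/
lemma sq_sum_norm_fourier_integral_le {f f' : ℝ → ℂ} (hf : ∀ t, HasDerivAt f (f' t) t)
    (hf' : Continuous f') (W : Finset ℤ) (μ : ℝ) {N : ℝ} (hN : 1 ≤ N) :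
    (∑ z ∈ W, ‖∫ t in -Real.pi..Real.pi, Complex.exp (-((z - μ) * t * Complex.I)) * f t‖) ^ 2 ≤
      3 * Real.pi * √N * (2 * Real.pi * (∫ t in -Real.pi..Real.pi, ‖f t‖ ^ 2) +
        (2 * (2 * Real.pi * ∫ t in -Real.pi..Real.pi, ‖f' t‖ ^ 2) +
          2 * (W.card * (‖f Real.pi‖ + ‖f (-Real.pi)‖) ^ 2)) / N) := by
  have hfc : Continuous f := continuous_iff_continuousAt.2 fun t => (hf t).continuousAt
  set c : ℤ → ℝ := fun z =>
    ‖∫ t in -Real.pi..Real.pi, Complex.exp (-((z - μ) * t * Complex.I)) * f t‖ with hc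
  set d : ℤ → ℝ := fun z =>
    ‖∫ t in -Real.pi..Real.pi, Complex.exp (-((z - μ) * t * Complex.I)) * f' t‖ with hd
  have hN0 : 0 < N := by linarith
  -- Cauchy–Schwarz with a weight that is bounded within `√N` of `μ` and still has a summable
  -- inverse.
  have hcs : (∑ z ∈ W, c z) ^ 2 ≤ (∑ z ∈ W, (1 + ((z : ℝ) - μ) ^ 2 / N)⁻¹) *
      ∑ z ∈ W, (1 + ((z : ℝ) - μ) ^ 2 / N) * c z ^ 2 := by
    refine Finset.sum_sq_le_sum_mul_sum_of_sq_le_mul W (fun z _ => by positivity)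
      (fun z _ => by positivity) fun z _ => ?_
    have : 1 + ((z : ℝ) - μ) ^ 2 / N ≠ 0 := by positivity
    exact (inv_mul_cancel_left₀ this _).ge
  have hcd : ∀ z : ℤ, ((z : ℝ) - μ) ^ 2 * c z ^ 2 ≤
      2 * d z ^ 2 + 2 * (‖f Real.pi‖ + ‖f (-Real.pi)‖) ^ 2 := by
    intro z
    have h := abs_mul_norm_fourier_integral_le hf hf' ((z : ℝ) - μ)
    push_cast at h
    have h2 := pow_le_pow_left₀ (by positivity) h 2
    rw [mul_pow, sq_abs] at h2
    refine h2.trans ?_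
    nlinarith [sq_nonneg (d z - (‖f Real.pi‖ + ‖f (-Real.pi)‖))]
  have hsum : ∑ z ∈ W, (1 + ((z : ℝ) - μ) ^ 2 / N) * c z ^ 2 ≤
      2 * Real.pi * (∫ t in -Real.pi..Real.pi, ‖f t‖ ^ 2) +
        (2 * (2 * Real.pi * ∫ t in -Real.pi..Real.pi, ‖f' t‖ ^ 2) +
          2 * (W.card * (‖f Real.pi‖ + ‖f (-Real.pi)‖) ^ 2)) / N := by
    calc _ = ∑ z ∈ W, c z ^ 2 + (∑ z ∈ W, ((z : ℝ) - μ) ^ 2 * c z ^ 2) / N := by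
          rw [Finset.sum_div, ← Finset.sum_add_distrib]
          exact Finset.sum_congr rfl fun z _ => by ring
      _ ≤ _ := by
          refine add_le_add (sum_sq_norm_fourier_integral_sub_le hfc W μ) ?_
          refine div_le_div_of_nonneg_right ?_ hN0.le
          refine (Finset.sum_le_sum fun z _ => hcd z).trans ?_
          rw [Finset.sum_add_distrib, ← Finset.mul_sum, Finset.sum_const, nsmul_eq_mul]
          have := sum_sq_norm_fourier_integral_sub_le hf' W μ
          linarith
  refine hcs.trans (mul_le_mul (sum_inv_one_add_sq_le W μ hN) hsum ?_ (by positivity))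
  exact Finset.sum_nonneg fun z _ => by positivity

lemma pow_mul_exp_neg_le {b y : ℝ} (hb : 0 < b) (hy : 0 ≤ y) (k : ℕ) :
    y ^ k * Real.exp (-(b * y)) ≤ k.factorial / b ^ k := by
  have h := Real.pow_div_factorial_le_exp (b * y) (by positivity) k
  rw [div_le_iff₀ (by positivity), mul_pow] at h
  rw [Real.exp_neg, ← div_eq_mul_inv, div_le_div_iff₀ (Real.exp_pos _) (by positivity)]
  linarith

lemma intervalIntegral_le_of_le_gaussian {f : ℝ → ℝ} (hf : Continuous f) {a b : ℝ} (hb : 0 < b)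
    (ha : 0 ≤ a) (h : ∀ t, |t| ≤ Real.pi → f t ≤ a * Real.exp (-(b * t ^ 2))) :
    ∫ t in -Real.pi..Real.pi, f t ≤ a * √(Real.pi / b) := by
  have hpi := Real.pi_pos
  have hle : -Real.pi ≤ Real.pi := by linarith
  have hint : Integrable fun t : ℝ => a * Real.exp (-(b * t ^ 2)) := by
    simpa only [neg_mul] using (integrable_exp_neg_mul_sq hb).const_mul a
  calc _ ≤ ∫ t in -Real.pi..Real.pi, a * Real.exp (-(b * t ^ 2)) :=
        intervalIntegral.integral_mono_on hle (hf.intervalIntegrable _ _)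
          hint.intervalIntegrable fun t ht => h t (abs_le.2 ht)
    _ ≤ ∫ t, a * Real.exp (-(b * t ^ 2)) := by
        rw [intervalIntegral.integral_of_le hle]
        exact setIntegral_le_integral hint (.of_forall fun t => by positivity)
    _ = _ := by
        rw [integral_const_mul, ← integral_gaussian]
        simp only [neg_mul]

/-- Taking `N = n`, the squared `L²` norms of `E` and `E'` are of order `n^(-3/2)` and `n^(-1/2)`,
so the squared sum is of order `√n (n^(-3/2) + n^(-1/2)/n) = 2/n`. -/
lemma sum_norm_fourier_integral_le_of_gaussian_bounds {E E' : ℝ → ℂ}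
    (hderiv : ∀ t, HasDerivAt E (E' t) t) (hE'c : Continuous E') {κ A A' : ℝ} (hκ0 : 0 < κ)
    (hA : 0 ≤ A) (hA' : 0 ≤ A') {n : ℕ} (hn : 1 ≤ n)
    (hbE : ∀ t, |t| ≤ Real.pi → ‖E t‖ ^ 2 ≤ A / n * Real.exp (-(κ * n * t ^ 2)))
    (hbE' : ∀ t, |t| ≤ Real.pi → ‖E' t‖ ^ 2 ≤ A' * Real.exp (-(κ * n * t ^ 2)))
    {W : Finset ℤ} (hW : W.card ≤ n + 1) (μ : ℝ) :
    ∑ z ∈ W, ‖∫ t in -Real.pi..Real.pi, Complex.exp (-((z - μ) * t * Complex.I)) * E t‖ ≤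
      √(3 * Real.pi * (2 * Real.pi * (A * √(Real.pi / κ)) +
        (2 * (2 * Real.pi * (A' * √(Real.pi / κ))) + 2 * (8 * A / κ)))) / √n := by
  have hpi := Real.pi_pos
  have hnR : (1 : ℝ) ≤ n := by exact_mod_cast hn
  have hn0 : (0 : ℝ) < n := by linarith
  have hsn : 0 < √(n : ℝ) := Real.sqrt_pos.2 hn0
  have hsn2 : √(n : ℝ) * √(n : ℝ) = n := Real.mul_self_sqrt hn0.le
  have hEc : Continuous E := continuous_iff_continuousAt.2 fun t => (hderiv t).continuousAt
  have hsq : √(Real.pi / (κ * n)) = √(Real.pi / κ) / √n := by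
    rw [← div_div, Real.sqrt_div (by positivity)]
  have hI := intervalIntegral_le_of_le_gaussian (by fun_prop) (show 0 < κ * n by positivity)
    (by positivity) hbE
  have hI' := intervalIntegral_le_of_le_gaussian (by fun_prop) (show 0 < κ * n by positivity)
    (by positivity) hbE'
  rw [hsq] at hI hI'
  -- The boundary terms occur once for each point of `W`; the Gaussian factor at `±π` makes up for
  -- this.
  have hbd : W.card * (‖E Real.pi‖ + ‖E (-Real.pi)‖) ^ 2 ≤ 8 * A / κ / √n := by
    have a1 := hbE Real.pi (abs_of_pos hpi).le
    have a2 := hbE (-Real.pi) (by rw [abs_neg, abs_of_pos hpi])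
    rw [neg_sq] at a2
    have a3 : (‖E Real.pi‖ + ‖E (-Real.pi)‖) ^ 2 ≤
        4 * (A / n * Real.exp (-(κ * n * Real.pi ^ 2))) := by
      have := add_sq_le (a := ‖E Real.pi‖) (b := ‖E (-Real.pi)‖)
      linarith
    have a4 : Real.exp (-(κ * n * Real.pi ^ 2)) ≤ 1 / (κ * √n) := by
      have hy := pow_mul_exp_neg_le hκ0 (show 0 ≤ n * Real.pi ^ 2 by positivity) 1
      rw [pow_one, ← mul_assoc, Nat.factorial_one, Nat.cast_one, pow_one, mul_comm] at hy
      rw [le_div_iff₀ (by positivity)] at hy ⊢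
      refine le_trans ?_ hy
      have h5 : √(n : ℝ) ≤ n * Real.pi ^ 2 := by
        have : √(n : ℝ) ≤ n := by
          rw [Real.sqrt_le_left hn0.le]
          nlinarith
        have : (n : ℝ) * 1 ≤ n * Real.pi ^ 2 := by
          gcongr
          nlinarith [Real.pi_gt_three]
        linarith
      calc _ = Real.exp (-(κ * n * Real.pi ^ 2)) * √n * κ := by ring
        _ ≤ Real.exp (-(κ * n * Real.pi ^ 2)) * (n * Real.pi ^ 2) * κ := by gcongr
    have a5 : (W.card : ℝ) ≤ 2 * n := by
      have : (W.card : ℝ) ≤ n + 1 := by exact_mod_cast hW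
      linarith
    calc _ ≤ (2 * n : ℝ) * (4 * (A / n * (1 / (κ * √n)))) := by
          refine mul_le_mul a5 (a3.trans ?_) (sq_nonneg _) (by positivity)
          gcongr
      _ = _ := by field_simp; ring
  have hfinal := sq_sum_norm_fourier_integral_le hderiv hE'c W μ hnR
  have hle : (∑ z ∈ W, ‖∫ t in -Real.pi..Real.pi,
      Complex.exp (-((z - μ) * t * Complex.I)) * E t‖) ^ 2 ≤ (3 * Real.pi *
      (2 * Real.pi * (A * √(Real.pi / κ)) +
        (2 * (2 * Real.pi * (A' * √(Real.pi / κ))) + 2 * (8 * A / κ)))) / n := by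
    refine hfinal.trans ?_
    calc _ ≤ 3 * Real.pi * √n * (2 * Real.pi * (A / n * (√(Real.pi / κ) / √n)) +
          (2 * (2 * Real.pi * (A' * (√(Real.pi / κ) / √n))) +
            2 * (8 * A / κ / √n)) / n) := by gcongr
      _ = _ := by
          field_simp
  have := Real.le_sqrt_of_sq_le hle
  rwa [Real.sqrt_div' _ hn0.le] at this

/-- The Fourier coefficients of the difference between the characteristic function of the 2-runs
statistic and that of the Gaussian with the same moments are of order `1 / √n` in `ℓ¹`. -/
lemma exists_sum_norm_centredCF_sub_gaussian_le {p : ℝ} (h0 : 0 < p) (h1 : p < 1) :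
    ∃ K : ℝ, 0 ≤ K ∧ ∀ n : ℕ, 7 ≤ n → ∀ W : Finset ℤ, W.card ≤ n + 1 → ∀ μ : ℝ,
      ∑ z ∈ W, ‖∫ t in -Real.pi..Real.pi, Complex.exp (-((z - μ) * t * Complex.I)) *
        (centredCF p n t -
          (Real.exp (-((n * (p ^ 2 + 2 * p ^ 3 - 3 * p ^ 4)) / 2 * t ^ 2)) : ℂ))‖ ≤ K / √n := by
  obtain ⟨C, hC0, hC⟩ := exists_norm_centredCFDefect_le h0.le h1.le
  have hpi := Real.pi_pos
  have hq : 0 < 1 - p := by linarith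
  set v := p ^ 2 + 2 * p ^ 3 - 3 * p ^ 4 with hv
  have hvpos : 0 < v := by
    have : v = p ^ 2 * ((1 - p) * (1 + 3 * p)) := by rw [hv]; ring
    rw [this]; positivity
  set κ := (p * (1 - p)) ^ 2 / (7 * Real.pi ^ 2) with hκ
  have hκ0 : 0 < κ := by positivity
  -- The decay rate of the error must not exceed that of the Gaussian for the integrating factor
  -- argument.
  have hκv : κ ≤ v / 2 := by
    have h2 : κ ≤ (p * (1 - p)) ^ 2 / 2 := by
      refine div_le_div_of_nonneg_left (by positivity) (by norm_num) ?_
      nlinarith [Real.pi_gt_three]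
    have h3 : (p * (1 - p)) ^ 2 ≤ v := by
      have : v - (p * (1 - p)) ^ 2 = p ^ 2 * (1 - p) * (4 * p) := by rw [hv]; ring
      have : 0 ≤ p ^ 2 * (1 - p) * (4 * p) := by positivity
      linarith
    linarith
  set C1 : ℝ := (Nat.factorial 3 : ℝ) / κ ^ 3 with hC1
  set C2 : ℝ := 2 * ((Nat.factorial 2 : ℝ) / κ ^ 2) + 2 * v ^ 2 * ((Nat.factorial 4 : ℝ) / κ ^ 4)
    with hC2
  have hC1' : 0 ≤ C1 := by positivity
  have hC2' : 0 ≤ C2 := by positivity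
  set K2 : ℝ := 3 * Real.pi * (2 * Real.pi * (C ^ 2 * C1 * √(Real.pi / κ)) +
    (2 * (2 * Real.pi * (C ^ 2 * C2 * √(Real.pi / κ))) + 2 * (8 * (C ^ 2 * C1) / κ))) with hK2
  refine ⟨√K2, Real.sqrt_nonneg _, fun n hn W hW μ => ?_⟩
  have hnR : (7 : ℝ) ≤ n := by exact_mod_cast hn
  have hn0 : (0 : ℝ) < n := by linarith
  have hne : n ≠ 0 := by omega
  have hψ := hasDerivAt_centredCF p hne
  rw [← hv] at hψ
  have hψ0 := centredCF_zero p hne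
  have hR : ∀ t, |t| ≤ Real.pi →
      ‖centredCFDefect p n t‖ ≤ C * n * t ^ 2 * Real.exp (-(κ * n * t ^ 2)) := hC n hn
  have hk : κ * n ≤ n * v / 2 := by nlinarith
  have hB : 0 ≤ C * n := by positivity
  have hs : 0 ≤ n * v := by positivity
  have hE := fun t => norm_sub_gaussian_le (t := t) hk hB hψ hψ0 hR
  have hE' := fun t => norm_deriv_sub_gaussian_le (t := t) hs hk hB hψ hψ0 hR
  have hderiv := hasDerivAt_sub_gaussian hψ
  set E : ℝ → ℂ := fun t => centredCF p n t - (Real.exp (-(n * v / 2 * t ^ 2)) : ℂ) with hEdef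
  set E' : ℝ → ℂ := fun t => -(n * v * t : ℝ) * E t + centredCFDefect p n t with hE'def
  have hE'c : Continuous E' := by
    have hEc : Continuous E := continuous_iff_continuousAt.2 fun t => (hderiv t).continuousAt
    have := continuous_centredCFDefect p n
    fun_prop
  -- Squaring doubles the exponent: one half absorbs the powers of `n t²`, the other is kept for
  -- integration.
  have hsplit : ∀ t : ℝ, Real.exp (-(κ * n * t ^ 2)) ^ 2 =
      Real.exp (-(κ * (n * t ^ 2))) * Real.exp (-(κ * n * t ^ 2)) := by
    intro t
    rw [pow_two, ← mul_assoc κ]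
  have hbE : ∀ t, |t| ≤ Real.pi → ‖E t‖ ^ 2 ≤ C ^ 2 * C1 / n * Real.exp (-(κ * n * t ^ 2)) := by
    intro t ht
    have hy := pow_mul_exp_neg_le hκ0 (show 0 ≤ n * t ^ 2 by positivity) 3
    calc ‖E t‖ ^ 2 ≤ (C * n * |t| ^ 3 * Real.exp (-(κ * n * t ^ 2))) ^ 2 :=
          pow_le_pow_left₀ (norm_nonneg _) (hE t ht) 2
      _ = C ^ 2 / n * ((n * t ^ 2) ^ 3 * Real.exp (-(κ * (n * t ^ 2)))) *
            Real.exp (-(κ * n * t ^ 2)) := by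
          rw [mul_pow, hsplit, mul_pow, ← pow_mul, mul_comm 3 2, pow_mul, sq_abs]
          field_simp
      _ ≤ C ^ 2 / n * C1 * Real.exp (-(κ * n * t ^ 2)) := by gcongr
      _ = _ := by ring
  have hbE' : ∀ t, |t| ≤ Real.pi → ‖E' t‖ ^ 2 ≤ C ^ 2 * C2 * Real.exp (-(κ * n * t ^ 2)) := by
    intro t ht
    have hy2 := pow_mul_exp_neg_le hκ0 (show 0 ≤ n * t ^ 2 by positivity) 2
    have hy4 := pow_mul_exp_neg_le hκ0 (show 0 ≤ n * t ^ 2 by positivity) 4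
    calc ‖E' t‖ ^ 2 ≤ (C * n * (t ^ 2 + n * v * t ^ 4) * Real.exp (-(κ * n * t ^ 2))) ^ 2 :=
          pow_le_pow_left₀ (norm_nonneg _) (hE' t ht) 2
      _ = C ^ 2 * ((n * t ^ 2 + v * (n * t ^ 2) ^ 2) ^ 2 * Real.exp (-(κ * (n * t ^ 2)))) *
            Real.exp (-(κ * n * t ^ 2)) := by
          rw [mul_pow, hsplit]
          ring
      _ ≤ C ^ 2 * ((2 * (n * t ^ 2) ^ 2 + 2 * v ^ 2 * (n * t ^ 2) ^ 4) *
            Real.exp (-(κ * (n * t ^ 2)))) * Real.exp (-(κ * n * t ^ 2)) := by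
          gcongr
          nlinarith [sq_nonneg (n * t ^ 2 - v * (n * t ^ 2) ^ 2)]
      _ = C ^ 2 * (2 * ((n * t ^ 2) ^ 2 * Real.exp (-(κ * (n * t ^ 2)))) +
            2 * v ^ 2 * ((n * t ^ 2) ^ 4 * Real.exp (-(κ * (n * t ^ 2))))) *
            Real.exp (-(κ * n * t ^ 2)) := by ring
      _ ≤ C ^ 2 * C2 * Real.exp (-(κ * n * t ^ 2)) := by
          rw [hC2]
          gcongr
  exact sum_norm_fourier_integral_le_of_gaussian_bounds hderiv hE'c hκ0 (by positivity)
    (by positivity) (by omega) hbE hbE' hW μ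

/-! ### Fourier inversion for integer laws and for the Gaussian -/

lemma integral_cexp_int_mul_I (m : ℤ) :
    ∫ t in -Real.pi..Real.pi, Complex.exp (m * t * Complex.I) = 
      if m = 0 then (2 * Real.pi : ℂ) else 0 := by
  split_ifs with h
  · simp [h]
    ring
  · have hm : (m * Complex.I : ℂ) ≠ 0 := mul_ne_zero (by exact_mod_cast h) Complex.I_ne_zero
    have e := integral_exp_mul_complex (a := -Real.pi) (b := Real.pi) hm
    have e' : ∀ t : ℝ, Complex.exp (m * t * Complex.I) = Complex.exp (m * Complex.I * t) := by
      intro t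
      congr 1
      ring
    simp only [e']
    rw [e, div_eq_zero_iff]
    left
    rw [sub_eq_zero, Complex.exp_eq_exp_iff_exists_int]
    exact ⟨m, by push_cast; ring⟩

lemma two_pi_mul_measureReal_singleton_eq {ν : Measure ℤ} [IsFiniteMeasure ν] {W : Finset ℤ}
    (hW : ν (W : Set ℤ)ᶜ = 0) {φ : ℝ → ℂ}
    (hφ : ∀ t : ℝ, φ t = ∫ k, Complex.exp (t * Complex.I * k) ∂ν) {z : ℤ} (hz : z ∈ W) :
    (2 * Real.pi * ν.real {z} : ℂ) =
      ∫ t in -Real.pi..Real.pi, Complex.exp (-(z * t * Complex.I)) * φ t := by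
  have hsum : ∀ t : ℝ, Complex.exp (-(z * t * Complex.I)) * φ t =
      ∑ k ∈ W, (ν.real {k} : ℂ) * Complex.exp ((k - z : ℤ) * t * Complex.I) := by
    intro t
    have hint : Integrable (fun k : ℤ => Complex.exp (t * Complex.I * k)) ν := by
      refine Integrable.of_bound AEStronglyMeasurable.of_discrete 1 (.of_forall fun k => ?_)
      rw [Complex.norm_exp]
      simp
    rw [hφ, ← setIntegral_eq_integral_of_ae_compl_eq_zero (s := (W : Set ℤ)),
      setIntegral_finset _ hint.integrableOn, Finset.mul_sum]
    · refine Finset.sum_congr rfl fun k _ => ?_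
      rw [Complex.real_smul, mul_left_comm, ← Complex.exp_add]
      congr 2
      push_cast
      ring
    · filter_upwards [measure_eq_zero_iff_ae_notMem.1 hW] with k hk hk'
      exact absurd hk' hk
  simp only [hsum]
  rw [intervalIntegral.integral_finsetSum
    fun k _ => Continuous.intervalIntegrable (by fun_prop) _ _]
  simp only [intervalIntegral.integral_const_mul, integral_cexp_int_mul_I, sub_eq_zero]
  simp only [mul_ite, mul_zero, Finset.sum_ite_eq', hz, if_true]
  ring

lemma integral_cexp_mul_gaussian {s : ℝ} (hs : 0 < s) (m y : ℝ) :
    ∫ t : ℝ, Complex.exp (-((y - m) * t * Complex.I)) * (Real.exp (-(s / 2 * t ^ 2)) : ℂ) =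
      2 * Real.pi * gaussianPDFReal m s.toNNReal y := by
  have h := fourierIntegral_gaussian (b := (s / 2 : ℂ)) (by simpa using hs) (-(y - m))
  have e : ∀ t : ℝ, Complex.exp (-((y - m) * t * Complex.I)) * (Real.exp (-(s / 2 * t ^ 2)) : ℂ) =
      Complex.exp (Complex.I * -(y - m) * t) * Complex.exp (-(s / 2) * t ^ 2) := by
    intro t
    push_cast
    congr 2 <;> ring
  simp only [e]
  rw [h, gaussianPDFReal_def, Real.coe_toNNReal _ hs.le]
  have e1 : ((Real.pi : ℂ) / (s / 2)) ^ (1 / 2 : ℂ) = (√(Real.pi / (s / 2)) : ℝ) := by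
    rw [Real.sqrt_eq_rpow, Complex.ofReal_cpow (by have := Real.pi_pos; positivity)]
    push_cast
    rfl
  have e2 : √(Real.pi / (s / 2)) = 2 * Real.pi * (√(2 * Real.pi * s))⁻¹ := by
    have hpi := Real.pi_pos
    rw [← div_eq_mul_inv, eq_div_iff (by positivity), ← Real.sqrt_mul (by positivity),
      Real.sqrt_eq_iff_mul_self_eq (by positivity) (by positivity)]
    field_simp
  rw [e1, e2]
  push_cast
  rw [mul_assoc]
  congr 3
  have : (s : ℂ) ≠ 0 := by exact_mod_cast hs.ne'
  field_simp
  ring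

lemma norm_integral_cexp_mul_gaussian_sub_le {s : ℝ} (hs : 0 < s) (m y : ℝ) :
    ‖(∫ t in -Real.pi..Real.pi, Complex.exp (-((y - m) * t * Complex.I)) *
        (Real.exp (-(s / 2 * t ^ 2)) : ℂ)) - 2 * Real.pi * gaussianPDFReal m s.toNNReal y‖ ≤
      Real.exp (-s) * √(4 * Real.pi / s) := by
  have hpi := Real.pi_pos
  have hn : ∀ t : ℝ, ‖Complex.exp (-((y - m) * t * Complex.I)) *
      (Real.exp (-(s / 2 * t ^ 2)) : ℂ)‖ = Real.exp (-(s / 2 * t ^ 2)) := by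
    intro t
    rw [norm_mul, Complex.norm_of_nonneg (Real.exp_pos _).le, Complex.norm_exp]
    simp
  have hg1 : Integrable fun t : ℝ => Real.exp (-(s / 2 * t ^ 2)) := by
    simpa only [neg_mul] using integrable_exp_neg_mul_sq (half_pos hs)
  have hg2 : Integrable fun t : ℝ => Real.exp (-s) * Real.exp (-(s / 4 * t ^ 2)) := by
    simpa only [neg_mul] using
      (integrable_exp_neg_mul_sq (show 0 < s / 4 by positivity)).const_mul (Real.exp (-s))
  have hint : Integrable fun t : ℝ => Complex.exp (-((y - m) * t * Complex.I)) *
      (Real.exp (-(s / 2 * t ^ 2)) : ℂ) :=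
    hg1.mono' (Continuous.aestronglyMeasurable (by fun_prop)) (.of_forall fun t => (hn t).le)
  rw [← integral_cexp_mul_gaussian hs, intervalIntegral.integral_of_le (by linarith),
    ← integral_add_compl (measurableSet_Ioc (a := -Real.pi) (b := Real.pi)) hint,
    sub_add_cancel_left, norm_neg]
  refine (norm_integral_le_integral_norm _).trans ?_
  simp only [hn]
  calc _ ≤ ∫ t in (Set.Ioc (-Real.pi) Real.pi)ᶜ, Real.exp (-s) * Real.exp (-(s / 4 * t ^ 2)) := by
        refine setIntegral_mono_on hg1.integrableOn hg2.integrableOn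
          measurableSet_Ioc.compl fun t ht => ?_
        rw [← Real.exp_add]
        refine Real.exp_le_exp.2 ?_
        -- Beyond `π` this gives `s t²/2 ≥ s + s t²/4`, which splits off the factor `exp (-s)`.
        have h4 : 4 ≤ t ^ 2 := by
          have h3 := Real.pi_gt_three
          rw [Set.mem_compl_iff, Set.mem_Ioc, not_and_or, not_lt, not_le] at ht
          rcases ht with ht | ht <;> nlinarith
        nlinarith
    _ ≤ ∫ t, Real.exp (-s) * Real.exp (-(s / 4 * t ^ 2)) :=
        setIntegral_le_integral hg2 (.of_forall fun t => by positivity)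
    _ = _ := by
        rw [integral_const_mul]
        have := integral_gaussian (s / 4)
        simp only [neg_mul] at this
        rw [this]
        congr 2
        field_simp

/-! ### Interval masses against density values -/

section Discretization

lemma hasDerivAt_gaussianPDFReal (m : ℝ) (v : NNReal) (y : ℝ) :
    HasDerivAt (gaussianPDFReal m v) (-((y - m) / v) * gaussianPDFReal m v y) y := by
  rw [gaussianPDFReal_def]
  refine (((((((hasDerivAt_id y).sub_const m).pow 2).neg).div_const (2 * (v : ℝ))).exp).const_mul
    _).congr_deriv ?_
  simp only [id, Pi.pow_apply, Pi.neg_apply]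
  by_cases hv : (v : ℝ) = 0
  · simp [hv]
  · push_cast
    field_simp

/-- Half of the Gaussian exponent absorbs the linear factor, through `u ≤ 3 exp (u²/4)` with `u = |y
- m| / √v`. What is left is an integrable Gaussian of variance `2v`. -/
lemma abs_deriv_gaussianPDFReal_le (m : ℝ) {v : NNReal} (hv : v ≠ 0) (y : ℝ) :
    |-((y - m) / v) * gaussianPDFReal m v y| ≤
      3 / √v * (√(2 * Real.pi * v))⁻¹ * Real.exp (-(1 / (4 * v) * (y - m) ^ 2)) := by
  have hv0 : (0 : ℝ) < v := by positivity
  have hs : 0 < √(v : ℝ) := Real.sqrt_pos.2 hv0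
  have hs2 : √(v : ℝ) ^ 2 = v := Real.sq_sqrt hv0.le
  set u := |y - m| / √v with hu
  have hu2 : u ^ 2 = (y - m) ^ 2 / v := by rw [hu, div_pow, sq_abs, hs2]
  have hu3 : u ≤ 3 * Real.exp (u ^ 2 / 4) := by
    have h1 := Real.add_one_le_exp (u ^ 2 / 4)
    nlinarith [sq_nonneg (u - 1)]
  have e1 : |y - m| / v = u / √v := by
    rw [hu, div_div, ← pow_two, hs2]
  have hpdf : gaussianPDFReal m v y =
      (√(2 * Real.pi * v))⁻¹ * (Real.exp (-(u ^ 2 / 4)) * Real.exp (-(u ^ 2 / 4))) := by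
    simp only [gaussianPDFReal]
    rw [← Real.exp_add, hu2]
    congr 2
    field_simp
    ring
  have e2 : -(1 / (4 * (v : ℝ)) * (y - m) ^ 2) = -(u ^ 2 / 4) := by
    rw [hu2]
    field_simp
  rw [abs_mul, abs_neg, abs_div, abs_of_pos hv0, e1, abs_of_nonneg (gaussianPDFReal_nonneg _ _ _),
    hpdf, e2]
  have h5 : u * Real.exp (-(u ^ 2 / 4)) ≤ 3 := by
    rw [Real.exp_neg, ← div_eq_mul_inv, div_le_iff₀ (Real.exp_pos _)]
    exact hu3
  calc _ = u * Real.exp (-(u ^ 2 / 4)) *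
        ((√v)⁻¹ * (√(2 * Real.pi * v))⁻¹ * Real.exp (-(u ^ 2 / 4))) := by
        field_simp
    _ ≤ 3 * ((√v)⁻¹ * (√(2 * Real.pi * v))⁻¹ * Real.exp (-(u ^ 2 / 4))) := by gcongr
    _ = _ := by field_simp

lemma abs_setIntegral_sub_le {g g' : ℝ → ℝ} (hg : ∀ y, HasDerivAt g (g' y) y)
    (hg' : Continuous g') (z : ℝ) :
    |(∫ y in Set.Ico (z - 1 / 2) (z + 1 / 2), g y) - g z| ≤
      ∫ y in Set.Ico (z - 1 / 2) (z + 1 / 2), |g' y| := by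
  have hgc : Continuous g := continuous_iff_continuousAt.2 fun t => (hg t).continuousAt
  have hI : IntegrableOn (fun y => |g' y|) (Set.Ico (z - 1 / 2) (z + 1 / 2)) :=
    (hg'.abs.integrableOn_Icc).mono_set Set.Ico_subset_Icc_self
  have hIg : IntegrableOn g (Set.Ico (z - 1 / 2) (z + 1 / 2)) :=
    (hgc.integrableOn_Icc).mono_set Set.Ico_subset_Icc_self
  have hvol : volume.real (Set.Ico (z - 1 / 2) (z + 1 / 2)) = 1 := by
    rw [measureReal_def, Real.volume_Ico]
    norm_num
  have hconst : ∫ _ in Set.Ico (z - 1 / 2) (z + 1 / 2), g z = g z := by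
    rw [setIntegral_const, hvol, one_smul]
  have hb : ∀ y ∈ Set.Ico (z - 1 / 2) (z + 1 / 2),
      ‖g y - g z‖ ≤ ∫ y in Set.Ico (z - 1 / 2) (z + 1 / 2), |g' y| := by
    intro y hy
    rw [← intervalIntegral.integral_eq_sub_of_hasDerivAt (fun u _ => hg u)
      (hg'.intervalIntegrable _ _)]
    refine intervalIntegral.norm_integral_le_integral_norm_uIoc.trans ?_
    refine setIntegral_mono_set hI (.of_forall fun _ => abs_nonneg _) (LE.le.eventuallyLE ?_)
    intro u hu
    rw [Set.mem_uIoc] at hu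
    obtain ⟨h1, h2⟩ := hy
    rcases hu with hu | hu
    · exact ⟨by linarith, by linarith⟩
    · exact ⟨by linarith, by linarith⟩
  have h := norm_setIntegral_le_of_norm_le_const (μ := volume) (by simp) hb
  rw [hvol, mul_one] at h
  rwa [integral_sub hIg (integrableOn_const (by simp) (by simp)), hconst] at h

/-- On each unit interval the error is at most the variation of the density there, and the intervals
are disjoint. The total variation is of order `1 / √v`. -/
lemma sum_abs_gaussianReal_Ico_sub_le (W : Finset ℤ) (m : ℝ) {v : NNReal} (hv : v ≠ 0) :
    ∑ z ∈ W, |(gaussianReal m v).real (Set.Ico ((z : ℝ) - 1 / 2) ((z : ℝ) + 1 / 2)) -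
      gaussianPDFReal m v z| ≤ 6 / √v := by
  have hv0 : (0 : ℝ) < v := by positivity
  have hs : 0 < √(v : ℝ) := Real.sqrt_pos.2 hv0
  have hpi := Real.pi_pos
  have hgc : Continuous (gaussianPDFReal m v) :=
    continuous_iff_continuousAt.2 fun t => (hasDerivAt_gaussianPDFReal m v t).continuousAt
  have hb : Integrable fun y : ℝ =>
      3 / √v * (√(2 * Real.pi * v))⁻¹ * Real.exp (-(1 / (4 * v) * (y - m) ^ 2)) := by
    have h := ((integrable_exp_neg_mul_sq (show 0 < 1 / (4 * (v : ℝ)) by positivity)).comp_sub_right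
      m).const_mul (3 / √v * (√(2 * Real.pi * v))⁻¹)
    simpa only [neg_mul] using h
  have hg' : Integrable fun y => |-((y - m) / v) * gaussianPDFReal m v y| :=
    hb.mono' (Continuous.aestronglyMeasurable (by fun_prop)) (.of_forall fun y => by
      rw [Real.norm_eq_abs, abs_abs]
      exact abs_deriv_gaussianPDFReal_le m hv y)
  calc _ ≤ ∑ z ∈ W, ∫ y in Set.Ico ((z : ℝ) - 1 / 2) ((z : ℝ) + 1 / 2),
        |-((y - m) / v) * gaussianPDFReal m v y| := by
        refine Finset.sum_le_sum fun z _ => ?_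
        rw [measureReal_def, gaussianReal_apply_eq_integral m hv, ENNReal.toReal_ofReal
          (integral_nonneg fun _ => gaussianPDFReal_nonneg _ _ _)]
        exact abs_setIntegral_sub_le (hasDerivAt_gaussianPDFReal m v) (by fun_prop) _
    _ ≤ ∫ y, |-((y - m) / v) * gaussianPDFReal m v y| :=
        sum_setIntegral_unit_le_integral hg' (fun _ => abs_nonneg _) W
    _ ≤ ∫ y, 3 / √v * (√(2 * Real.pi * v))⁻¹ * Real.exp (-(1 / (4 * v) * (y - m) ^ 2)) :=
        integral_mono hg' hb fun y => abs_deriv_gaussianPDFReal_le m hv y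
    _ = 3 / √v * (√(2 * Real.pi * v))⁻¹ * √(Real.pi / (1 / (4 * v))) := by
        rw [integral_const_mul,
          integral_sub_right_eq_self (fun y => Real.exp (-(1 / (4 * v) * y ^ 2))) m,
          ← integral_gaussian]
        simp only [neg_mul]
    _ ≤ _ := by
        have h1 : √(Real.pi / (1 / (4 * v))) ≤ 2 * √(2 * Real.pi * v) := by
          rw [Real.sqrt_le_left (by positivity), mul_pow, Real.sq_sqrt (by positivity)]
          have : Real.pi / (1 / (4 * (v : ℝ))) = 4 * (Real.pi * v) := by field_simp
          rw [this]
          nlinarith [mul_pos hpi hv0]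
        calc _ ≤ 3 / √v * (√(2 * Real.pi * v))⁻¹ * (2 * √(2 * Real.pi * v)) := by gcongr
          _ = _ := by
            field_simp
            norm_num

end Discretization

/-! ### Total variation on the integers -/

section TotalVariation

lemma discretizedNormal_singleton (m v : ℝ) (z : ℤ) :
    discretizedNormal m v {z} =
      gaussianReal m v.toNNReal (Set.Ico ((z : ℝ) - 1 / 2) ((z : ℝ) + 1 / 2)) := by
  rw [discretizedNormal, Measure.sum_apply _ (measurableSet_singleton z), tsum_eq_single z]
  · simp
  · intro k hk
    simp [hk]

instance (m v : ℝ) : IsProbabilityMeasure (discretizedNormal m v) := by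
  constructor
  rw [discretizedNormal, Measure.sum_apply _ MeasurableSet.univ]
  have e : ∀ z : ℤ, Set.Ico ((z : ℝ) - 1 / 2) ((z : ℝ) + 1 / 2) =
      Set.Ico ((-1 / 2 : ℝ) + z) ((-1 / 2 : ℝ) + z + 1) := by
    intro z
    congr 1 <;> ring
  simp only [e, Measure.smul_apply, measure_univ, smul_eq_mul, mul_one]
  rw [← measure_iUnion (Set.pairwise_disjoint_Ico_add_intCast (-1 / 2 : ℝ))
    fun _ => measurableSet_Ico, iUnion_Ico_add_intCast, measure_univ]

/-- Mass of `Q` outside `W` only lowers `ν(A) - Q(A)`, so that difference is controlled on `W`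
alone; the opposite sign follows by passing to the complement. -/
lemma tvDist_le_sum {ν Q : Measure ℤ} [IsProbabilityMeasure ν] [IsProbabilityMeasure Q]
    {W : Finset ℤ} (hW : ν (W : Set ℤ)ᶜ = 0) :
    tvDist ν Q ≤ ∑ z ∈ W, |ν.real {z} - Q.real {z}| := by
  classical
  have key : ∀ A : Set ℤ, ν.real A - Q.real A ≤ ∑ z ∈ W, |ν.real {z} - Q.real {z}| := by
    intro A
    have hν : ν.real A = ∑ z ∈ W with z ∈ A, ν.real {z} := by
      rw [sum_measureReal_singleton]
      refine measureReal_congr ?_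
      filter_upwards [measure_eq_zero_iff_ae_notMem.1 hW] with k hk
      have hk' : k ∈ W := by simpa using hk
      refine propext ⟨fun h => ?_, fun h => ?_⟩
      · exact Finset.mem_coe.2 (Finset.mem_filter.2 ⟨hk', h⟩)
      · exact (Finset.mem_filter.1 (Finset.mem_coe.1 h)).2
    have hQ : ∑ z ∈ W with z ∈ A, Q.real {z} ≤ Q.real A := by
      rw [sum_measureReal_singleton]
      exact measureReal_mono fun k hk => (Finset.mem_filter.1 (Finset.mem_coe.1 hk)).2
    calc _ ≤ ∑ z ∈ W with z ∈ A, (ν.real {z} - Q.real {z}) := by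
          rw [Finset.sum_sub_distrib]
          linarith
      _ ≤ ∑ z ∈ W with z ∈ A, |ν.real {z} - Q.real {z}| :=
          Finset.sum_le_sum fun z _ => le_abs_self _
      _ ≤ _ := Finset.sum_le_sum_of_subset_of_nonneg (Finset.filter_subset _ _)
          fun _ _ _ => abs_nonneg _
  have : Nonempty {A : Set ℤ // MeasurableSet A} := ⟨⟨∅, MeasurableSet.empty⟩⟩
  refine ciSup_le fun A => abs_le.2 ⟨?_, key _⟩
  have h := key A.1ᶜ
  rw [probReal_compl_eq_one_sub A.2, probReal_compl_eq_one_sub A.2] at h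
  linarith

end TotalVariation

/-! ### Assembly of the estimate -/

section MainResult

variable {Ω : Type*} [MeasurableSpace Ω] {P : Measure Ω} {p : unitInterval} {n : ℕ}
  {ζ : Fin n → Ω → ℤ}

lemma map_twoRuns_compl_Icc_eq_zero
    (hζ : ∀ i, HasLaw (ζ i) (bernoulliMeasure (1 : ℤ) 0 p) P) :
    P.map (twoRuns ζ) ((Finset.Icc (0 : ℤ) n : Finset ℤ) : Set ℤ)ᶜ = 0 := by
  rw [Measure.map_apply_of_aemeasurable (aemeasurable_twoRuns hζ)
    (Set.to_countable _).measurableSet, measure_eq_zero_iff_ae_notMem]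
  filter_upwards [ae_all_iff.2 fun i => ae_eq_zero_or_one_of_hasLaw_bernoulli (hζ i)] with ω hω
  have h : ∀ i, 0 ≤ ζ i ω * ζ (finRotate n i) ω ∧ ζ i ω * ζ (finRotate n i) ω ≤ 1 := by
    intro i
    rcases hω i with h | h <;> rcases hω (finRotate n i) with h' | h' <;> rw [h, h'] <;> norm_num
  have h0 : 0 ≤ twoRuns ζ ω := Finset.sum_nonneg fun i _ => (h i).1
  have h1 : twoRuns ζ ω ≤ n := by
    have := Finset.sum_le_sum (s := Finset.univ) fun i _ => (h i).2
    simpa [twoRuns] using this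
  simp [h0, h1]

lemma two_pi_mul_map_twoRuns_real_singleton (hn : n ≠ 0)
    (hζ : ∀ i, HasLaw (ζ i) (bernoulliMeasure (1 : ℤ) 0 p) P) (hind : iIndepFun ζ P)
    {z : ℤ} (hz : z ∈ Finset.Icc (0 : ℤ) n) :
    (2 * Real.pi * (P.map (twoRuns ζ)).real {z} : ℂ) =
      ∫ t in -Real.pi..Real.pi, Complex.exp (-((z - (n * (p : ℝ) ^ 2 : ℝ)) * t * Complex.I)) *
        centredCF p n t := by
  have := hind.isProbabilityMeasure
  rw [two_pi_mul_measureReal_singleton_eq (map_twoRuns_compl_Icc_eq_zero hζ) (φ := fun t =>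
    (transferMatrix (p : ℝ) (Complex.exp (t * Complex.I)) ^ n).trace) ?_ hz]
  · refine intervalIntegral.integral_congr fun t _ => ?_
    simp only [centredCF]
    rw [← mul_assoc, ← Complex.exp_add]
    congr 2
    push_cast
    ring
  · intro t
    rw [← integral_cexp_twoRuns hn hζ hind, integral_map (aemeasurable_twoRuns hζ)
      AEStronglyMeasurable.of_discrete]

/-- The variance is zero, so the statistic is almost surely its mean, an integer `k`; the
discretized point mass at `k` is the same law. -/
lemma tvDist_eq_zero_of_degenerate (hn : 3 ≤ n) (hp : (p : ℝ) = 0 ∨ (p : ℝ) = 1)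
    (hζ : ∀ i, HasLaw (ζ i) (bernoulliMeasure (1 : ℤ) 0 p) P) (hind : iIndepFun ζ P) :
    tvDist (P.map (twoRuns ζ))
      (discretizedNormal (n * (p : ℝ) ^ 2)
        (n * ((p : ℝ) ^ 2 + 2 * (p : ℝ) ^ 3 - 3 * (p : ℝ) ^ 4))) ≤ 0 := by
  have := hind.isProbabilityMeasure
  have hmeas := aemeasurable_twoRuns hζ
  have := Measure.isProbabilityMeasure_map hmeas
  have hv : n * ((p : ℝ) ^ 2 + 2 * (p : ℝ) ^ 3 - 3 * (p : ℝ) ^ 4) = 0 := by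
    rcases hp with h | h <;> rw [h] <;> norm_num
  obtain ⟨k, hk⟩ : ∃ k : ℤ, n * (p : ℝ) ^ 2 = k := by
    rcases hp with h | h
    · exact ⟨0, by simp [h]⟩
    · exact ⟨n, by simp [h]⟩
  have hL : MemLp (fun ω => (twoRuns ζ ω : ℝ)) 2 P := by
    simp only [twoRuns, Int.cast_sum, Int.cast_mul]
    exact memLp_finsetSum _ fun i _ => memLp_twoRuns_summand hζ i 2
  have hvar := variance_twoRuns hn hζ hind
  rw [hv] at hvar
  have hev : evariance (fun ω => (twoRuns ζ ω : ℝ)) P = 0 := by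
    rw [← hL.ofReal_variance_eq, hvar, ENNReal.ofReal_zero]
  rw [evariance_eq_zero_iff hL.aestronglyMeasurable.aemeasurable, integral_twoRuns hn hζ hind, hk]
    at hev
  have hS : ∀ᵐ ω ∂P, twoRuns ζ ω = k := by
    filter_upwards [hev] with ω hω
    exact_mod_cast hω
  have hW : P.map (twoRuns ζ) (({k} : Finset ℤ) : Set ℤ)ᶜ = 0 := by
    rw [Measure.map_apply_of_aemeasurable hmeas (Set.to_countable _).measurableSet,
      measure_eq_zero_iff_ae_notMem]
    filter_upwards [hS] with ω hω
    simp [hω]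
  have hone : (P.map (twoRuns ζ)).real {k} = 1 := by
    have h := probReal_compl_eq_one_sub (μ := P.map (twoRuns ζ)) (measurableSet_singleton k)
    rw [measureReal_def, ← Finset.coe_singleton, hW, Finset.coe_singleton] at h
    simp only [ENNReal.toReal_zero] at h
    linarith
  refine (tvDist_le_sum hW).trans (le_of_eq ?_)
  rw [Finset.sum_singleton, hone, measureReal_def, discretizedNormal_singleton, hv, hk]
  simp

lemma exists_tvDist_le {p : unitInterval} (h0 : 0 < (p : ℝ)) (h1 : (p : ℝ) < 1) :
    ∃ c : ℝ, ∀ (n : ℕ), 7 ≤ n →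
      ∀ (Ω : Type*) [MeasurableSpace Ω] (P : Measure Ω) [IsProbabilityMeasure P]
        (ζ : Fin n → Ω → ℤ),
        (∀ i, HasLaw (ζ i) (bernoulliMeasure (1 : ℤ) 0 p) P) →
        iIndepFun ζ P →
        tvDist (P.map (twoRuns ζ))
          (discretizedNormal (n * (p : ℝ) ^ 2)
            (n * ((p : ℝ) ^ 2 + 2 * (p : ℝ) ^ 3 - 3 * (p : ℝ) ^ 4))) ≤ c / √(n : ℝ) := by
  obtain ⟨K, hK0, hK⟩ := exists_sum_norm_centredCF_sub_gaussian_le h0 h1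
  have hpi := Real.pi_pos
  have hq : 0 < 1 - (p : ℝ) := by linarith
  set v := (p : ℝ) ^ 2 + 2 * (p : ℝ) ^ 3 - 3 * (p : ℝ) ^ 4 with hv
  have hvpos : 0 < v := by
    have : v = (p : ℝ) ^ 2 * ((1 - p) * (1 + 3 * p)) := by rw [hv]; ring
    rw [this]; positivity
  -- The three summands come from the characteristic functions on `[-π, π]`, the Gaussian integral
  -- outside it, and discretization.
  refine ⟨K + 2 / v * √(4 * Real.pi / v) + 6 / √v, fun n hn Ω _ P _ ζ hζ hind => ?_⟩
  have hmeas := aemeasurable_twoRuns hζ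
  have := Measure.isProbabilityMeasure_map hmeas
  have hnR : (7 : ℝ) ≤ n := by exact_mod_cast hn
  have hn0 : (0 : ℝ) < n := by linarith
  have hsn : 0 < √(n : ℝ) := Real.sqrt_pos.2 hn0
  have hs : 0 < n * v := by positivity
  have hsv : ((n * v).toNNReal : ℝ) = n * v := Real.coe_toNNReal _ hs.le
  have hsv0 : (n * v).toNNReal ≠ 0 := (Real.toNNReal_pos.2 hs).ne'
  set m := n * (p : ℝ) ^ 2 with hm
  set W := Finset.Icc (0 : ℤ) n with hWdef
  have hcard : W.card = n + 1 := by simp [hWdef]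
  set g := gaussianPDFReal m (n * v).toNNReal with hg
  set A : ℤ → ℝ := fun z => ‖∫ t in -Real.pi..Real.pi,
    Complex.exp (-((z - m) * t * Complex.I)) *
      (centredCF p n t - (Real.exp (-(n * v / 2 * t ^ 2)) : ℂ))‖ with hA
  have hterm : ∀ z ∈ W, |(P.map (twoRuns ζ)).real {z} - g z| ≤
      A z + Real.exp (-(n * v)) * √(4 * Real.pi / (n * v)) := by
    intro z hz
    have e1 := two_pi_mul_map_twoRuns_real_singleton (by omega) hζ hind hz
    have e2 := norm_integral_cexp_mul_gaussian_sub_le hs m z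
    have hcc : Continuous (centredCF p n) := continuous_iff_continuousAt.2 fun t =>
      (hasDerivAt_centredCF p (by omega) t).continuousAt
    have e3 : (2 * Real.pi * ((P.map (twoRuns ζ)).real {z} - g z : ℝ) : ℂ) =
        (∫ t in -Real.pi..Real.pi, Complex.exp (-((z - m) * t * Complex.I)) *
          (centredCF p n t - (Real.exp (-(n * v / 2 * t ^ 2)) : ℂ))) +
        ((∫ t in -Real.pi..Real.pi, Complex.exp (-((z - m) * t * Complex.I)) *
          (Real.exp (-(n * v / 2 * t ^ 2)) : ℂ)) - 2 * Real.pi * g z) := by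
      simp only [mul_sub]
      rw [intervalIntegral.integral_sub (Continuous.intervalIntegrable (by fun_prop) _ _)
        (Continuous.intervalIntegrable (by fun_prop) _ _), ← e1]
      push_cast
      ring
    have e4 : ‖(2 * Real.pi * ((P.map (twoRuns ζ)).real {z} - g z : ℝ) : ℂ)‖ =
        2 * Real.pi * |(P.map (twoRuns ζ)).real {z} - g z| := by
      rw [norm_mul, norm_mul, Complex.norm_real, Complex.norm_real, Real.norm_eq_abs,
        Real.norm_eq_abs, abs_of_pos hpi]
      simp
    -- The factor `2π ≥ 1` from Fourier inversion is simply dropped.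
    have e5 : |(P.map (twoRuns ζ)).real {z} - g z| ≤
        2 * Real.pi * |(P.map (twoRuns ζ)).real {z} - g z| := by
      have := abs_nonneg ((P.map (twoRuns ζ)).real {z} - g z)
      nlinarith [Real.pi_gt_three]
    refine e5.trans ?_
    rw [← e4, e3]
    refine (norm_add_le _ _).trans (add_le_add le_rfl ?_)
    simpa using e2
  have hsumA : ∑ z ∈ W, A z ≤ K / √n := hK n hn W hcard.le m
  have hsumG := sum_abs_gaussianReal_Ico_sub_le W m hsv0
  rw [hsv, Real.sqrt_mul hn0.le] at hsumG
  -- Only `exp (-n v) ≤ 1 / (n v)` is needed to offset the `n + 1` points of `W`; the factor `1 /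
  -- √n` comes from the Gaussian integral.
  have hexp : (W.card : ℝ) * (Real.exp (-(n * v)) * √(4 * Real.pi / (n * v))) ≤
      2 / v * √(4 * Real.pi / v) / √n := by
    have h2 : Real.exp (-(n * v)) ≤ 1 / (n * v) := by
      rw [Real.exp_neg, ← one_div]
      exact one_div_le_one_div_of_le hs (by linarith [Real.add_one_le_exp (n * v)])
    have h3 : √(4 * Real.pi / (n * v)) = √(4 * Real.pi / v) / √n := by
      rw [mul_comm (n : ℝ), ← div_div, Real.sqrt_div (by positivity)]
    have h4 : (W.card : ℝ) ≤ 2 * n := by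
      rw [hcard]
      push_cast
      linarith
    rw [h3]
    calc _ ≤ (2 * n : ℝ) * (1 / (n * v) * (√(4 * Real.pi / v) / √n)) := by gcongr
      _ = _ := by field_simp
  calc _ ≤ ∑ z ∈ W, |(P.map (twoRuns ζ)).real {z} - (discretizedNormal m (n * v)).real {z}| :=
        tvDist_le_sum (map_twoRuns_compl_Icc_eq_zero hζ)
    _ ≤ ∑ z ∈ W, ((A z + Real.exp (-(n * v)) * √(4 * Real.pi / (n * v))) +
          |(gaussianReal m (n * v).toNNReal).real
            (Set.Ico ((z : ℝ) - 1 / 2) ((z : ℝ) + 1 / 2)) - g z|) := by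
        refine Finset.sum_le_sum fun z hz => ?_
        rw [measureReal_def (discretizedNormal m (n * v)), discretizedNormal_singleton,
          ← measureReal_def]
        refine (abs_sub_le _ (g z) _).trans (add_le_add (hterm z hz) (le_of_eq (abs_sub_comm _ _)))
    _ = ∑ z ∈ W, A z + (W.card : ℝ) * (Real.exp (-(n * v)) * √(4 * Real.pi / (n * v))) +
          ∑ z ∈ W, |(gaussianReal m (n * v).toNNReal).real
            (Set.Ico ((z : ℝ) - 1 / 2) ((z : ℝ) + 1 / 2)) - g z| := by
        rw [Finset.sum_add_distrib, Finset.sum_add_distrib, Finset.sum_const, nsmul_eq_mul]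
    _ ≤ K / √n + 2 / v * √(4 * Real.pi / v) / √n + 6 / (√n * √v) :=
        add_le_add (add_le_add hsumA hexp) hsumG
    _ = _ := by field_simp

end MainResult

theorem mainTheorem4 (p : unitInterval) :
    ∃ c : ℝ, ∀ (n : ℕ), 7 ≤ n →
      ∀ (Ω : Type*) [MeasurableSpace Ω] (P : Measure Ω) [IsProbabilityMeasure P]
        (ζ : Fin n → Ω → ℤ),
        (∀ i, HasLaw (ζ i) (bernoulliMeasure (1 : ℤ) 0 p) P) →
        iIndepFun ζ P →
        ∫ ω, (twoRuns ζ ω : ℝ) ∂P = n * (p : ℝ) ^ 2 ∧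
        variance (fun ω => (twoRuns ζ ω : ℝ)) P
          = n * ((p : ℝ) ^ 2 + 2 * (p : ℝ) ^ 3 - 3 * (p : ℝ) ^ 4) ∧
        tvDist (P.map (twoRuns ζ))
          (discretizedNormal (n * (p : ℝ) ^ 2)
            (n * ((p : ℝ) ^ 2 + 2 * (p : ℝ) ^ 3 - 3 * (p : ℝ) ^ 4))) ≤ c / √(n : ℝ) := by
  by_cases hp : (p : ℝ) = 0 ∨ (p : ℝ) = 1
  · refine ⟨0, fun n hn Ω _ P _ ζ hζ hind => ⟨integral_twoRuns (by omega) hζ hind,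
      variance_twoRuns (by omega) hζ hind, ?_⟩⟩
    rw [zero_div]
    exact tvDist_eq_zero_of_degenerate (by omega) hp hζ hind
  · rw [not_or] at hp
    obtain ⟨c, hc⟩ := exists_tvDist_le (lt_of_le_of_ne p.2.1 (Ne.symm hp.1))
      (lt_of_le_of_ne p.2.2 hp.2)
    exact ⟨c, fun n hn Ω _ P _ ζ hζ hind => ⟨integral_twoRuns (by omega) hζ hind,
      variance_twoRuns (by omega) hζ hind, hc n hn Ω P ζ hζ hind⟩⟩
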